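/- Proposition (lifting of Hamiltonian torus actions). Let $(B,\omega)$ be a compact connected symplectic manifold, let $\pi:P\to B$ be a principal $S^1$-bundle, $S^1=\mathbb{R}/\mathbb{Z}$ being identified with $U(1)$ by $\theta\mapsto e^{2\pi i\theta}$, and let $R$ be the vector field on $P$ generating the $S^1$-action. Let $\alpha$ be a connection 1-form on $P$ (a smooth $S^1$-invariant real 1-form with $\alpha(R)=1$) such that $d\alpha=\pi^*\omega$; so $[\omega]$ is integral and $P$ is the prequantum circle bundle of $(B,\omega)$. Let a torus $T=\mathbb{R}^n/\mathbb{Z}^n$ with Lie algebra $\mathfrak{t}=\mathbb{R}^n$ act on $(B,\omega)$ in a Hamiltonian way with moment map $\Phi:B\to\mathfrak{t}^*$; that is, the action is smooth and preserves $\omega$, $\Phi$ is smooth and $T$-invariant, and $d\Phi^X=\iota(X_B)\omega$ for all $X\in\mathfrak{t}$, where $\Phi^X=\langle\Phi,X\rangle$ and $X_B(b)=\frac{d}{dt}\big|_{t=0}\exp(tX)\cdot b$. Then the action of $T$ on $B$ has a fixed point, and for every fixed point $b_0\in B^T$ there is a smooth action of $T$ on $P$ which preserves $\alpha$, makes $\pi$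 equivariant, and whose induced vector fields are $$X_P = X_B^h-\pi^*\big(\Phi^X-\Phi^X(b_0)\big)\,R\qquad (X\in\mathfrak{t}),$$ where $X_B^h$ is the horizontal lift of $X_B$ with respect to $\alpha$ (that is, $\alpha(X_B^h)=0$ and $d\pi(X_B^h)=X_B$). In particular, if $\Phi$ is normalized by $\Phi(b_0)=0$, then $X_P=X_B^h-(\pi^*\Phi^X)R$. -/

import Mathlib

open Set Topology
open scoped Manifold ContDiff

noncomputable section

/-! ### Differential forms on manifolds without boundary -/

/-- A (not necessarily smooth) real `k`-form on a manifold `M` modelled on `E`. -/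
abbrev MForm (E : Type*) [NormedAddCommGroup E] [NormedSpace ℝ E]
    (M : Type*) [TopologicalSpace M] [ChartedSpace E M] (k : ℕ) : Type _ :=
  (x : M) → TangentSpace 𝓘(ℝ, E) x [⋀^Fin k]→L[ℝ] ℝ

namespace MForm

variable {E : Type*} [NormedAddCommGroup E] [NormedSpace ℝ E]
  {M : Type*} [TopologicalSpace M] [ChartedSpace E M]
  {F : Type*} [NormedAddCommGroup F] [NormedSpace ℝ F]
  {N : Type*} [TopologicalSpace N] [ChartedSpace F N] {k : ℕ}

/-- The pullback `f^* η` of a form along a map `f : M → N`. -/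
def pullback (f : M → N) (η : MForm F N k) : MForm E M k := fun x =>
  (η (f x)).compContinuousLinearMap (mfderiv 𝓘(ℝ, E) 𝓘(ℝ, F) f x)

/-- The expression of a form in the preferred chart at `x₀`: its pullback along the inverse
of the chart. It is meaningful on the target of the chart. -/
def inChart (η : MForm E M k) (x₀ : M) (y : E) : E [⋀^Fin k]→L[ℝ] ℝ :=
  (η ((extChartAt 𝓘(ℝ, E) x₀).symm y)).compContinuousLinearMap
    (mfderiv 𝓘(ℝ, E) 𝓘(ℝ, E) (extChartAt 𝓘(ℝ, E) x₀).symm y)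

/-- A form is smooth if its coefficients in the charts are smooth. -/
def IsSmooth (η : MForm E M k) : Prop :=
  ∀ x₀ : M, ContDiffOn ℝ ∞ (η.inChart x₀) (extChartAt 𝓘(ℝ, E) x₀).target

/-- The exterior derivative: at `x` it is computed in the chart at `x`
and carried back to the tangent space. -/
def d (η : MForm E M k) : MForm E M (k + 1) := fun x =>
  (extDeriv (η.inChart x) (extChartAt 𝓘(ℝ, E) x x)).compContinuousLinearMap
    (mfderiv 𝓘(ℝ, E) 𝓘(ℝ, E) (extChartAt 𝓘(ℝ, E) x) x)

end MForm

/-- `Ω` is a symplectic form: a smooth closed nondegenerate two-form. -/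
structure IsSymplecticForm {E : Type*} [NormedAddCommGroup E] [NormedSpace ℝ E]
    {M : Type*} [TopologicalSpace M] [ChartedSpace E M] (Ω : MForm E M 2) : Prop where
  smooth : Ω.IsSmooth
  closed : ∀ x : M, Ω.d x = 0
  nondegenerate : ∀ (x : M) (v : TangentSpace 𝓘(ℝ, E) x),
    (∀ w : TangentSpace 𝓘(ℝ, E) x, Ω x ![v, w] = 0) → v = 0

/-! ### Torus actions -/

/-- The `n`-dimensional torus; its Lie algebra is `Fin n → ℝ`. -/
abbrev Torus (n : ℕ) : Type := Fin n → Circle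

/-- The exponential map of the torus, normalized so that its kernel, the integral lattice,
is `ℤⁿ`. It identifies the torus with `ℝⁿ / ℤⁿ`. -/
def torusExp {n : ℕ} (X : Fin n → ℝ) : Torus n := fun j => Circle.exp (2 * Real.pi * X j)

/-- The action map `T × M → M` is smooth, `T` being the quotient `ℝⁿ / ℤⁿ` with its quotient
smooth structure (`torusExp` is a surjective local diffeomorphism, so smoothness may be
tested after composing with it). -/
def IsSmoothTorusAction (n : ℕ) (E : Type*) [NormedAddCommGroup E] [NormedSpace ℝ E]
    (M : Type*) [TopologicalSpace M] [ChartedSpace E M] [MulAction (Torus n) M] : Prop :=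
  ContMDiff (𝓘(ℝ, Fin n → ℝ).prod 𝓘(ℝ, E)) 𝓘(ℝ, E) ∞
    (fun q : (Fin n → ℝ) × M => torusExp q.1 • q.2)

/-- The vector field `X_M` induced on `M` by an element `X` of the Lie algebra of the torus:
`X_M(x)` is the derivative at `t = 0` of `exp(tX) • x`. -/
def inducedField (E : Type*) [NormedAddCommGroup E] [NormedSpace ℝ E]
    {M : Type*} [TopologicalSpace M] [ChartedSpace E M] {n : ℕ} [MulAction (Torus n) M]
    (X : Fin n → ℝ) (x : M) : TangentSpace 𝓘(ℝ, E) x :=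
  (mfderiv 𝓘(ℝ, ℝ) 𝓘(ℝ, E) (fun t : ℝ => torusExp (t • X) • x) 0 (1 : ℝ) : E)

/-- The torus acts on `(M, Ω)` in a Hamiltonian way with moment map `Φ`. Equivariance of `Φ`
is invariance, since the coadjoint action of a torus is trivial. -/
structure IsHamiltonianTorusAction {E : Type*} [NormedAddCommGroup E] [NormedSpace ℝ E]
    {M : Type*} [TopologicalSpace M] [ChartedSpace E M] {n : ℕ} [MulAction (Torus n) M]
    (Ω : MForm E M 2) (Φ : M → ((Fin n → ℝ) →L[ℝ] ℝ)) : Prop where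
  smooth_action : IsSmoothTorusAction n E M
  symplectic : ∀ g : Torus n, MForm.pullback (fun x : M => g • x) Ω = Ω
  smooth_moment : ContMDiff 𝓘(ℝ, E) 𝓘(ℝ, (Fin n → ℝ) →L[ℝ] ℝ) ∞ Φ
  invariant : ∀ (g : Torus n) (x : M), Φ (g • x) = Φ x
  /-- `dΦ^X = ι(X_M) Ω`. -/
  moment : ∀ (X : Fin n → ℝ) (x : M) (v : TangentSpace 𝓘(ℝ, E) x),
    (mfderiv 𝓘(ℝ, E) 𝓘(ℝ, ℝ) (fun y : M => Φ y X) x v : ℝ) = Ω x ![inducedField E X x, v]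

/-! ### Principal circle bundles and connections -/

/-- `π : P → B`, with the given action of the circle on `P`, is a smooth principal circle
bundle: it has smooth equivariant local trivializations. -/
structure IsPrincipalCircleBundle (F : Type*) [NormedAddCommGroup F] [NormedSpace ℝ F]
    (E : Type*) [NormedAddCommGroup E] [NormedSpace ℝ E]
    {P : Type*} [TopologicalSpace P] [ChartedSpace F P] [MulAction Circle P]
    {B : Type*} [TopologicalSpace B] [ChartedSpace E B] (π : P → B) : Prop where
  smooth_proj : ContMDiff 𝓘(ℝ, F) 𝓘(ℝ, E) ∞ π
  smooth_action : ContMDiff ((𝓡 1).prod 𝓘(ℝ, F)) 𝓘(ℝ, F) ∞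
    (fun q : Circle × P => q.1 • q.2)
  proj_smul : ∀ (z : Circle) (p : P), π (z • p) = π p
  locally_trivial : ∀ b : B, ∃ e : Bundle.Trivialization Circle π, b ∈ e.baseSet ∧
    ContMDiffOn 𝓘(ℝ, F) (𝓘(ℝ, E).prod (𝓡 1)) ∞ e e.source ∧
    ContMDiffOn (𝓘(ℝ, E).prod (𝓡 1)) 𝓘(ℝ, F) ∞ e.toOpenPartialHomeomorph.symm e.target ∧
    ∀ (z : Circle), ∀ p ∈ e.source, e (z • p) = ((e p).1, z * (e p).2)

/-- The vector field `R` generating the circle action, with the circle regarded as `ℝ / ℤ`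
through `θ ↦ exp(2πiθ)`. -/
def circleField (F : Type*) [NormedAddCommGroup F] [NormedSpace ℝ F]
    {P : Type*} [TopologicalSpace P] [ChartedSpace F P] [MulAction Circle P]
    (p : P) : TangentSpace 𝓘(ℝ, F) p :=
  (mfderiv 𝓘(ℝ, ℝ) 𝓘(ℝ, F) (fun t : ℝ => Circle.exp (2 * Real.pi * t) • p) 0 (1 : ℝ) : F)

/-- `α` is a connection one-form: smooth, invariant under the circle, and `α(R) = 1`. -/
structure IsConnectionForm {F : Type*} [NormedAddCommGroup F] [NormedSpace ℝ F]
    {P : Type*} [TopologicalSpace P] [ChartedSpace F P] [MulAction Circle P]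
    (α : MForm F P 1) : Prop where
  smooth : α.IsSmooth
  invariant : ∀ z : Circle, MForm.pullback (fun p : P => z • p) α = α
  normalized : ∀ p : P, α p ![circleField F p] = 1

/-- `v` is the horizontal lift to `p` of the tangent vector `w` at `π p`. -/
def IsHorizontalLift {F : Type*} [NormedAddCommGroup F] [NormedSpace ℝ F]
    {E : Type*} [NormedAddCommGroup E] [NormedSpace ℝ E]
    {P : Type*} [TopologicalSpace P] [ChartedSpace F P]
    {B : Type*} [TopologicalSpace B] [ChartedSpace E B]
    (α : MForm F P 1) (π : P → B) (p : P)
    (w : TangentSpace 𝓘(ℝ, E) (π p)) (v : TangentSpace 𝓘(ℝ, F) p) : Prop :=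
  α p ![v] = 0 ∧ mfderiv 𝓘(ℝ, F) 𝓘(ℝ, E) π p v = w

end

/-!
Everything is derived from a single identity. Write `c = Φ b₀`. A smooth map
`ψ : ℝⁿ × P → P` lifting `(Y, b) ↦ exp Y • b`, with `ψ (0, p) = p`, is looked for, such that
`ψ^* α = α - (Φ ∘ π - c) dY` as one-forms in `(Y, p)` (`IsMomentLift`). The `dp`-part of the
identity says that every `ψ (Y, ·)` preserves `α`; the `dY`-part says that the vertical part of the
induced field of `X` is `-(Φ^X - c X) R`.

*Uniqueness.* If two lifts of the same map from a convex open set pull `α` back to the same form,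
the circle-valued map by which they differ has zero logarithmic derivative, hence is constant
(`IsPrincipalCircleBundle.exists_smul_eqOn_of_pullDual_eq`).

*Local existence.* With a local section `s`, one compares the lifts `f₀ = s ∘ τ` and
`f₁ (Y, y) = s (exp Y • τ y)`, `τ` being the inverse of a chart of `B`, and looks for `g` such that
`exp (2πig) • f₁` has the required pullback. This means
`dg = f₀^* α - f₁^* α - (Φ ∘ τ - c) dY`. The right-hand side is closed because `dα = π^* Ω`, the
action preserves `Ω`, its orbits are isotropic and `dΦ^X = ι(X_B) Ω`
(`fderiv_momentDefect_symm`); the Poincaré lemma on a ball then gives `g`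
(`exists_isMomentLift_nhds`).

*Globalization.* By uniqueness the local lifts agree on overlaps, and compactness of `B` gives a
lift `ψ` for all `p` and all small `Y` (`exists_isMomentLift_univ`). Uniqueness also gives
`ψ (Y + Z, p) = ψ (Y, ψ (Z, p))` for small `Y` and `Z`, so that `ψ` extends to an action of `ℝⁿ`,
as any local homomorphism does (`exists_extension_of_local_hom`). For `exp Y = 1` the map
`ψ (Y, ·)` is a gauge transformation preserving `α`; it is the identity over `b₀`, where the
constant family is a lift too, and therefore everywhere, `B` being connected
(`IsMomentLift.apply_eq_self_of_torusExp_eq_one`). Thus the action descends to the torus.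

*Fixed points.* By Baire's theorem there is `X` generating a dense one-parameter subgroup. At a
maximum of `Φ^X` the differential `ι(X_B) Ω` vanishes, so `X_B` does, and the point is fixed by
`exp (tX)` for all `t`, hence by the torus (`IsHamiltonianTorusAction.fixedPoints_nonempty`).
-/

/-! ### Derivatives in the model space and pullbacks of one-forms -/

section ModelDeriv

variable {V : Type*} [NormedAddCommGroup V] [NormedSpace ℝ V] {H : Type*} [TopologicalSpace H]
  {I : ModelWithCorners ℝ V H} {M : Type*} [TopologicalSpace M] [ChartedSpace H M]
  {V' : Type*} [NormedAddCommGroup V'] [NormedSpace ℝ V'] {H' : Type*} [TopologicalSpace H']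
  {I' : ModelWithCorners ℝ V' H'} {M' : Type*} [TopologicalSpace M'] [ChartedSpace H' M']
  {V'' : Type*} [NormedAddCommGroup V''] [NormedSpace ℝ V''] {H'' : Type*} [TopologicalSpace H'']
  {I'' : ModelWithCorners ℝ V'' H''} {M'' : Type*} [TopologicalSpace M''] [ChartedSpace H'' M'']

variable (I I') in
/-- The derivative `mfderiv I I' f m`, regarded as a map between the model vector spaces rather
than between the (definitionally equal) tangent spaces. The type does not depend on the points,
which makes it possible to rewrite base points. -/
noncomputable def modelDeriv (f : M → M') (m : M) : V →L[ℝ] V' := mfderiv I I' f m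

theorem modelDeriv_comp {f : M' → M''} {g : M → M'} {m : M}
    (hf : MDifferentiableAt I' I'' f (g m)) (hg : MDifferentiableAt I I' g m) :
    modelDeriv I I'' (fun x => f (g x)) m = (modelDeriv I' I'' f (g m)).comp (modelDeriv I I' g m) :=
  mfderiv_comp m hf hg

theorem modelDeriv_congr {f g : M → M'} {m : M} (h : f =ᶠ[𝓝 m] g) :
    modelDeriv I I' f m = modelDeriv I I' g m :=
  h.mfderiv_eq

theorem modelDeriv_eq_fderiv {f : V → V'} {x : V} :
    modelDeriv 𝓘(ℝ, V) 𝓘(ℝ, V') f x = fderiv ℝ f x := mfderiv_eq_fderiv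

theorem modelDeriv_id {m : M} : modelDeriv I I (fun x : M => x) m = ContinuousLinearMap.id ℝ V :=
  mfderiv_id

theorem modelDeriv_const {m : M} {c : M'} : modelDeriv I I' (fun _ : M => c) m = 0 :=
  mfderiv_const

theorem modelDeriv_prodMk {f : M → M'} {g : M → M''} {m : M}
    (hf : MDifferentiableAt I I' f m) (hg : MDifferentiableAt I I'' g m) :
    modelDeriv I (I'.prod I'') (fun x => (f x, g x)) m =
      (modelDeriv I I' f m).prod (modelDeriv I I'' g m) :=
  hf.mfderiv_prod hg

theorem modelDeriv_fst {x : M × M'} :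
    modelDeriv (I.prod I') I Prod.fst x = ContinuousLinearMap.fst ℝ V V' := mfderiv_fst

theorem modelDeriv_snd {x : M × M'} :
    modelDeriv (I.prod I') I' Prod.snd x = ContinuousLinearMap.snd ℝ V V' := mfderiv_snd

theorem modelDeriv_uncurry {f : M × M' → M''} {x : M} {y : M'}
    (hf : MDifferentiableAt (I.prod I') I'' f (x, y)) (v : V) (w : V') :
    modelDeriv (I.prod I') I'' f (x, y) (v, w) =
      modelDeriv I I'' (fun z => f (z, y)) x v + modelDeriv I' I'' (fun z => f (x, z)) y w :=
  mfderiv_prod_eq_add_apply hf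

theorem mdifferentiableAt_slice_right {f : M × M' → M''} {x : M} {y : M'}
    (hf : MDifferentiableAt (I.prod I') I'' f (x, y)) :
    MDifferentiableAt I' I'' (fun z => f (x, z)) y :=
  hf.comp y (mdifferentiableAt_const.prodMk mdifferentiableAt_id)

end ModelDeriv

namespace MForm

variable {F : Type*} [NormedAddCommGroup F] [NormedSpace ℝ F]
  {P : Type*} [TopologicalSpace P] [ChartedSpace F P]
  {G : Type*} [NormedAddCommGroup G] [NormedSpace ℝ G]
  {V : Type*} [NormedAddCommGroup V] [NormedSpace ℝ V] {H : Type*} [TopologicalSpace H]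
  {I : ModelWithCorners ℝ V H} {M : Type*} [TopologicalSpace M] [ChartedSpace H M]
  {V' : Type*} [NormedAddCommGroup V'] [NormedSpace ℝ V'] {H' : Type*} [TopologicalSpace H']
  {I' : ModelWithCorners ℝ V' H'} {M' : Type*} [TopologicalSpace M'] [ChartedSpace H' M']
  {k : ℕ}

/-- The value of a form at a point, as an alternating map on the model space. -/
def model (η : MForm F P k) (p : P) : F [⋀^Fin k]→L[ℝ] ℝ := η p

/-- A one-form as a field of continuous linear functionals. -/
noncomputable def toDual (α : MForm F P 1) (p : P) : F →L[ℝ] ℝ :=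
  (ContinuousAlternatingMap.ofSubsingleton ℝ F ℝ (0 : Fin 1)).symm (α.model p)

theorem ofSubsingleton_symm_apply (a : F [⋀^Fin 1]→L[ℝ] ℝ) (v : F) :
    (ContinuousAlternatingMap.ofSubsingleton ℝ F ℝ (0 : Fin 1)).symm a v = a ![v] := by
  change a _ = a _
  congr 1
  ext i
  fin_cases i; rfl

theorem toDual_apply (α : MForm F P 1) (p : P) (v : F) : α.toDual p v = α.model p ![v] :=
  ofSubsingleton_symm_apply _ _

variable (I) in
/-- The pullback of a one-form along a map `f : M → P`, where `M` is a manifold with an arbitrary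
model (for instance a product), as a field of continuous linear functionals. -/
noncomputable def pullDual (α : MForm F P 1) (f : M → P) (m : M) : V →L[ℝ] ℝ :=
  (α.toDual (f m)).comp (modelDeriv I 𝓘(ℝ, F) f m)

theorem pullDual_apply (α : MForm F P 1) (f : M → P) (m : M) (v : V) :
    pullDual I α f m v = α.toDual (f m) (modelDeriv I 𝓘(ℝ, F) f m v) := rfl

theorem pullDual_comp (α : MForm F P 1) {f : M → P} {g : M' → M} {m : M'}
    (hf : MDifferentiableAt I 𝓘(ℝ, F) f (g m)) (hg : MDifferentiableAt I' I g m) :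
    pullDual I' α (fun x => f (g x)) m = (pullDual I α f (g m)).comp (modelDeriv I' I g m) := by
  unfold pullDual
  rw [modelDeriv_comp hf hg]
  rfl

theorem pullDual_congr (α : MForm F P 1) {f g : M → P} {m : M} (h : f =ᶠ[𝓝 m] g) :
    pullDual I α f m = pullDual I α g m := by
  unfold pullDual
  rw [modelDeriv_congr h, h.self_of_nhds]

/-- The pullback of a form to a normed space, read in a chart of the target. -/
theorem pullback_eq_inChart [IsManifold 𝓘(ℝ, F) ∞ P] (α : MForm F P k) (x₀ : P) {f : G → P} {x : G}
    (hx : f x ∈ (extChartAt 𝓘(ℝ, F) x₀).source)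
    (hf : MDifferentiableAt 𝓘(ℝ, G) 𝓘(ℝ, F) f x) :
    (pullback (E := G) f α).model x =
      (α.inChart x₀ (extChartAt 𝓘(ℝ, F) x₀ (f x))).compContinuousLinearMap
        (fderiv ℝ (fun z => extChartAt 𝓘(ℝ, F) x₀ (f z)) x) := by
  set ψ := extChartAt 𝓘(ℝ, F) x₀
  have h1 : ψ.symm (ψ (f x)) = f x := ψ.left_inv hx
  have hsrc : f x ∈ (chartAt F x₀).source := by rwa [← extChartAt_source 𝓘(ℝ, F)]
  have hd : MDifferentiableAt 𝓘(ℝ, F) 𝓘(ℝ, F) ψ (f x) := mdifferentiableAt_extChartAt hsrc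
  have hd' : MDifferentiableAt 𝓘(ℝ, F) 𝓘(ℝ, F) ψ.symm (ψ (f x)) := by
    have := mdifferentiableWithinAt_extChartAt_symm (I := 𝓘(ℝ, F)) (ψ.map_source hx)
    rwa [modelWithCornersSelf_coe, range_id, mdifferentiableWithinAt_univ] at this
  have h2 : modelDeriv 𝓘(ℝ, G) 𝓘(ℝ, F) f x = (modelDeriv 𝓘(ℝ, F) 𝓘(ℝ, F) ψ.symm (ψ (f x))).comp
      (fderiv ℝ (fun z => ψ (f z)) x) := by
    have hc : MDifferentiableAt 𝓘(ℝ, G) 𝓘(ℝ, F) (fun z => ψ (f z)) x := hd.comp x hf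
    rw [← modelDeriv_eq_fderiv, ← modelDeriv_comp (g := fun z => ψ (f z)) hd' hc]
    apply modelDeriv_congr
    have := hf.continuousAt ((isOpen_extChartAt_source (I := 𝓘(ℝ, F)) x₀).mem_nhds hx)
    filter_upwards [this] with z hz
    exact (ψ.left_inv hz).symm
  change (α.model (f x)).compContinuousLinearMap (modelDeriv 𝓘(ℝ, G) 𝓘(ℝ, F) f x) =
    ((α.model (ψ.symm (ψ (f x)))).compContinuousLinearMap
      (modelDeriv 𝓘(ℝ, F) 𝓘(ℝ, F) ψ.symm (ψ (f x)))).compContinuousLinearMap _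
  rw [h1, h2]
  rfl

section Smooth

variable {f : G → P} {O : Set G}

theorem contDiffAt_extChartAt_comp
    (hO : IsOpen O) (hf : ContMDiffOn 𝓘(ℝ, G) 𝓘(ℝ, F) ∞ f O) {x : G} (hx : x ∈ O) :
    ContDiffAt ℝ ∞ (fun z => extChartAt 𝓘(ℝ, F) (f x) (f z)) x := by
  rw [← contMDiffAt_iff_contDiffAt]
  exact (contMDiffAt_extChartAt (n := ∞)).comp x (hf.contMDiffAt (hO.mem_nhds hx))

theorem IsSmooth.contDiffAt_inChart {α : MForm F P k} (hα : α.IsSmooth) (p : P) :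
    ContDiffAt ℝ ∞ (α.inChart p) (extChartAt 𝓘(ℝ, F) p p) :=
  (hα p).contDiffAt (extChartAt_target_mem_nhds p)

variable [IsManifold 𝓘(ℝ, F) ∞ P]

theorem eventually_pullback_eq_inChart (α : MForm F P k)
    (hO : IsOpen O) (hf : ContMDiffOn 𝓘(ℝ, G) 𝓘(ℝ, F) ∞ f O) {x : G} (hx : x ∈ O) :
    (pullback (E := G) f α).model =ᶠ[𝓝 x] fun y =>
      (α.inChart (f x) (extChartAt 𝓘(ℝ, F) (f x) (f y))).compContinuousLinearMap
        (fderiv ℝ (fun z => extChartAt 𝓘(ℝ, F) (f x) (f z)) y) := by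
  have hc := (hf.continuousOn.continuousAt (hO.mem_nhds hx))
    ((isOpen_extChartAt_source (I := 𝓘(ℝ, F)) (f x)).mem_nhds (mem_extChartAt_source (f x)))
  filter_upwards [hc, hO.mem_nhds hx] with y hy hyO
  exact pullback_eq_inChart α (f x) hy
    ((hf.contMDiffAt (hO.mem_nhds hyO)).mdifferentiableAt (by simp))

theorem IsSmooth.contDiffOn_pullDual {α : MForm F P 1} (hα : α.IsSmooth)
    (hO : IsOpen O) (hf : ContMDiffOn 𝓘(ℝ, G) 𝓘(ℝ, F) ∞ f O) :
    ContDiffOn ℝ ∞ (pullDual 𝓘(ℝ, G) α f) O := by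
  intro x hx
  apply ContDiffAt.contDiffWithinAt
  set h := fun z => extChartAt 𝓘(ℝ, F) (f x) (f z)
  have hh' : ContDiffAt ℝ ∞ h x := contDiffAt_extChartAt_comp hO hf hx
  let L := (ContinuousAlternatingMap.ofSubsingletonLIE (𝕜 := ℝ) (E := F) (F := ℝ) (0 : Fin 1)).symm
  have h1 : ContDiffAt ℝ ∞ (fun y => (L (α.inChart (f x) (h y))).comp (fderiv ℝ h y)) x := by
    refine ContDiffAt.clm_comp ?_ (hh'.fderiv_right (by simp))
    exact L.contDiff.contDiffAt.comp x
      (ContDiffAt.comp (g := α.inChart (f x)) x (hα.contDiffAt_inChart (f x)) hh')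
  refine h1.congr_of_eventuallyEq ?_
  filter_upwards [eventually_pullback_eq_inChart α hO hf hx] with y hy
  ext v
  have := congrArg (fun a => a ![v]) hy
  rw [pullDual_apply, toDual_apply]
  refine Eq.trans ?_ (this.trans ?_)
  · change α.model (f y) _ = α.model (f y) _
    congr 1
    ext i; fin_cases i; rfl
  · change α.inChart _ _ _ = α.inChart _ _ _
    congr 1
    ext i; fin_cases i; rfl

/-- The exterior derivative commutes with pullback to an open subset of a normed space. -/
theorem IsSmooth.extDeriv_pullback {α : MForm F P k} (hα : α.IsSmooth)
    (hO : IsOpen O) (hf : ContMDiffOn 𝓘(ℝ, G) 𝓘(ℝ, F) ∞ f O) {x : G} (hx : x ∈ O) :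
    extDeriv (pullback (E := G) f α).model x = (pullback (E := G) f α.d).model x := by
  have hh' := contDiffAt_extChartAt_comp hO hf hx
  have h1 : fderiv ℝ (fun z => extChartAt 𝓘(ℝ, F) (f x) (f z)) x =
      (modelDeriv 𝓘(ℝ, F) 𝓘(ℝ, F) (extChartAt 𝓘(ℝ, F) (f x)) (f x)).comp
        (modelDeriv 𝓘(ℝ, G) 𝓘(ℝ, F) f x) := by
    rw [← modelDeriv_eq_fderiv]
    exact modelDeriv_comp (mdifferentiableAt_extChartAt (mem_chart_source F (f x)))
      ((hf.contMDiffAt (hO.mem_nhds hx)).mdifferentiableAt (by simp))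
  rw [(eventually_pullback_eq_inChart α hO hf hx).extDeriv_eq]
  refine (_root_.extDeriv_pullback (x := x) (r := ∞)
    (f := fun z => extChartAt 𝓘(ℝ, F) (f x) (f z))
    (show DifferentiableAt ℝ (α.inChart (f x)) _ from
      (hα.contDiffAt_inChart (f x)).differentiableAt (by simp)) hh' ?_).trans ?_
  · rw [minSmoothness_of_isRCLikeNormedField]; exact WithTop.coe_le_coe.2 (le_top : (2 : ℕ∞) ≤ ⊤)
  rw [h1]
  rfl

/-- The exterior derivative of a pulled back one-form, computed as the antisymmetrization of its
derivative. -/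
theorem IsSmooth.fderiv_pullDual_sub {α : MForm F P 1} (hα : α.IsSmooth)
    (hO : IsOpen O) (hf : ContMDiffOn 𝓘(ℝ, G) 𝓘(ℝ, F) ∞ f O) {x : G} (hx : x ∈ O) (v w : G) :
    fderiv ℝ (pullDual 𝓘(ℝ, G) α f) x v w - fderiv ℝ (pullDual 𝓘(ℝ, G) α f) x w v =
      α.d.model (f x)
        ![modelDeriv 𝓘(ℝ, G) 𝓘(ℝ, F) f x v, modelDeriv 𝓘(ℝ, G) 𝓘(ℝ, F) f x w] := by
  have hd : DifferentiableAt ℝ (pullDual 𝓘(ℝ, G) α f) x :=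
    ((hα.contDiffOn_pullDual hO hf).contDiffAt (hO.mem_nhds hx)).differentiableAt (by simp)
  let L := ContinuousAlternatingMap.ofSubsingletonLIE (𝕜 := ℝ) (E := G) (F := ℝ) (0 : Fin 1)
  have hL : (pullback (E := G) f α).model = fun y => L (pullDual 𝓘(ℝ, G) α f y) := by
    ext y m
    change α.model (f y) _ = α.model (f y) _
    congr 1
    ext i; fin_cases i; rfl
  have h1 := hα.extDeriv_pullback hO hf hx
  have h2 := congrArg (fun a => a ![v, w]) h1
  have hd' : DifferentiableAt ℝ (pullback (E := G) f α).model x := by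
    rw [hL]; exact L.differentiable.differentiableAt.comp x hd
  have h3 : ∀ m : Fin 1 → G, ∀ u, fderiv ℝ (fun y => (pullback (E := G) f α).model y m) x u =
      fderiv ℝ (pullDual 𝓘(ℝ, G) α f) x u (m 0) := by
    intro m u
    have : (fun y => (pullback (E := G) f α).model y m) =
        fun y => pullDual 𝓘(ℝ, G) α f y (m 0) := by
      rw [hL]; rfl
    rw [this, fderiv_clm_apply hd (differentiableAt_const _)]
    simp
  simp only [extDeriv_apply hd', h3] at h2
  have h4 : (pullback (E := G) f α.d).model x ![v, w] = α.d.model (f x)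
        ![modelDeriv 𝓘(ℝ, G) 𝓘(ℝ, F) f x v, modelDeriv 𝓘(ℝ, G) 𝓘(ℝ, F) f x w] := by
    change α.d.model (f x) _ = α.d.model (f x) _
    congr 1
    ext i; fin_cases i <;> rfl
  rw [← h4, ← h2]
  simp [Fin.removeNth, sub_eq_add_neg]

end Smooth

end MForm

/-! ### Connection forms and circle-valued maps -/

section CircleActions

variable {F : Type*} [NormedAddCommGroup F] [NormedSpace ℝ F]
  {P : Type*} [TopologicalSpace P] [ChartedSpace F P] [MulAction Circle P]
  {V : Type*} [NormedAddCommGroup V] [NormedSpace ℝ V] {H : Type*} [TopologicalSpace H]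
  {I : ModelWithCorners ℝ V H} {M : Type*} [TopologicalSpace M] [ChartedSpace H M]

theorem mdifferentiableAt_circle_coe (z : Circle) :
    MDifferentiableAt (𝓡 1) 𝓘(ℝ, ℂ) (fun w : Circle => (w : ℂ)) z :=
  haveI := finrank_real_complex_fact'
  (contMDiff_coe_sphere (m := 1) (n := 1) (E := ℂ) z).mdifferentiableAt one_ne_zero

theorem mdifferentiableAt_circleExp_two_pi (t : ℝ) :
    MDifferentiableAt 𝓘(ℝ, ℝ) (𝓡 1) (fun s : ℝ => Circle.exp (2 * Real.pi * s)) t := by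
  have h1 : MDifferentiableAt 𝓘(ℝ, ℝ) 𝓘(ℝ, ℝ) (fun s : ℝ => 2 * Real.pi * s) t :=
    ((differentiableAt_id (𝕜 := ℝ)).const_mul _).mdifferentiableAt
  exact ((contMDiff_circleExp (m := 1) _).mdifferentiableAt one_ne_zero).comp t h1

/-- A differentiable circle-valued map has a differentiable logarithm near each point. -/
theorem exists_circle_log {w : M → Circle} {m : M} (hw : MDifferentiableAt I (𝓡 1) w m) :
    ∃ u : M → ℝ, MDifferentiableAt I 𝓘(ℝ, ℝ) u m ∧
      ∀ x, w x = Circle.exp (2 * Real.pi * u x) * w m := by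
  let ρ : ℂ → ℝ := fun z => (2 * Real.pi)⁻¹ * (Complex.log (z * (w m : ℂ)⁻¹)).im
  have hρ : DifferentiableAt ℝ ρ (w m : ℂ) := by
    have h1 : DifferentiableAt ℂ (fun z : ℂ => Complex.log (z * (w m : ℂ)⁻¹)) (w m : ℂ) := by
      refine (differentiableAt_id.mul_const _).clog ?_
      simp [Complex.one_mem_slitPlane]
    have h2 := h1.restrictScalars ℝ
    have h3 := (Complex.imCLM.differentiableAt (x := Complex.log (w m * (w m : ℂ)⁻¹))).comp
      (w m : ℂ) h2
    exact h3.const_mul _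
  refine ⟨fun x => ρ (w x), ?_, fun x => ?_⟩
  · exact MDifferentiableAt.comp (g := ρ) (f := fun x => (w x : ℂ)) m hρ.mdifferentiableAt
      ((mdifferentiableAt_circle_coe (w m)).comp m hw)
  · have h : 2 * Real.pi * ρ (w x) = Complex.arg ((w x * (w m)⁻¹ : Circle) : ℂ) := by
      simp only [ρ, Complex.log_im, Circle.coe_mul, Circle.coe_inv]
      have := Real.pi_ne_zero
      field_simp
    rw [h, Circle.exp_arg, inv_mul_cancel_right]

namespace IsConnectionForm

variable {α : MForm F P 1}

theorem toDual_smul (hα : IsConnectionForm α) (z : Circle) (p : P) (v : F) :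
    α.toDual (z • p) (modelDeriv 𝓘(ℝ, F) 𝓘(ℝ, F) (fun q : P => z • q) p v) = α.toDual p v := by
  have h := congrArg (fun β : MForm F P 1 => β.toDual p v) (hα.invariant z)
  refine Eq.trans ?_ h
  rw [MForm.toDual_apply, MForm.toDual_apply]
  change α.model (z • p) _ = α.model (z • p) _
  congr 1
  ext i; fin_cases i; rfl

theorem pullDual_const_smul (hα : IsConnectionForm α)
    (hact : ContMDiff ((𝓡 1).prod 𝓘(ℝ, F)) 𝓘(ℝ, F) ∞ (fun q : Circle × P => q.1 • q.2))
    (z : Circle) {f : M → P} {m : M} (hf : MDifferentiableAt I 𝓘(ℝ, F) f m) :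
    MForm.pullDual I α (fun x => z • f x) m = MForm.pullDual I α f m := by
  have hz : MDifferentiableAt 𝓘(ℝ, F) 𝓘(ℝ, F) (fun q : P => z • q) (f m) :=
    (hact.comp ((contMDiff_const (c := z)).prodMk contMDiff_id) (f m)).mdifferentiableAt (by simp)
  ext v
  rw [MForm.pullDual_apply, modelDeriv_comp hz hf]
  exact hα.toDual_smul z _ _

/-- The gauge transformation rule: acting on a map by `exp (2πiu)` changes the pullback of a
connection form by `du`. -/
theorem pullDual_exp_smul (hα : IsConnectionForm α)
    (hact : ContMDiff ((𝓡 1).prod 𝓘(ℝ, F)) 𝓘(ℝ, F) ∞ (fun q : Circle × P => q.1 • q.2))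
    {u : M → ℝ} {f : M → P} {m : M} (hu : MDifferentiableAt I 𝓘(ℝ, ℝ) u m)
    (hf : MDifferentiableAt I 𝓘(ℝ, F) f m) :
    MForm.pullDual I α (fun x => Circle.exp (2 * Real.pi * u x) • f x) m =
      MForm.pullDual I α f m + modelDeriv I 𝓘(ℝ, ℝ) u m := by
  let K : ℝ × P → P := fun q => Circle.exp (2 * Real.pi * q.1) • q.2
  have hK : ∀ q, MDifferentiableAt (𝓘(ℝ, ℝ).prod 𝓘(ℝ, F)) 𝓘(ℝ, F) K q := by
    intro q
    have h1 : MDifferentiableAt ((𝓡 1).prod 𝓘(ℝ, F)) 𝓘(ℝ, F) (fun q : Circle × P => q.1 • q.2)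
      (Circle.exp (2 * Real.pi * q.1), q.2) := (hact _).mdifferentiableAt (by simp)
    refine MDifferentiableAt.comp (g := fun q : Circle × P => q.1 • q.2)
      (f := fun q : ℝ × P => (Circle.exp (2 * Real.pi * q.1), q.2)) q h1
      (MDifferentiableAt.prodMk ?_ mdifferentiableAt_snd)
    exact (mdifferentiableAt_circleExp_two_pi q.1).comp q mdifferentiableAt_fst
  have hK1 : ∀ (p : P) (t : ℝ), MDifferentiableAt 𝓘(ℝ, ℝ) 𝓘(ℝ, F) (fun s => K (s, p)) t :=
    fun p t => (hK (t, p)).comp t (mdifferentiableAt_id.prodMk mdifferentiableAt_const)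
  ext v
  rw [MForm.pullDual_comp (f := K) (g := fun x => (u x, f x)) α (hK _) (hu.prodMk hf),
    modelDeriv_prodMk hu hf]
  set t := u m
  set s := modelDeriv I 𝓘(ℝ, ℝ) u m v
  set y := modelDeriv I 𝓘(ℝ, F) f m v
  change α.toDual (K (t, f m)) (modelDeriv (𝓘(ℝ, ℝ).prod 𝓘(ℝ, F)) 𝓘(ℝ, F) K (t, f m) (s, y)) =
    α.toDual (f m) y + s
  rw [modelDeriv_uncurry (hK _), map_add, add_comm]
  congr 1
  · exact hα.toDual_smul _ _ _
  · -- the curve through `K (t, p)` is a translate of the orbit defining the generating field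
    have h2 : (fun z => K (z, f m)) = fun z => K (z - t, K (t, f m)) := by
      ext z
      simp only [K, smul_smul, ← Circle.exp_add]
      congr 2; ring
    have hsub : MDifferentiableAt 𝓘(ℝ, ℝ) 𝓘(ℝ, ℝ) (fun z : ℝ => z - t) t :=
      (differentiableAt_id.sub_const t).mdifferentiableAt
    rw [h2, modelDeriv_comp (f := fun z => K (z, K (t, f m))) (hK1 _ _) hsub, modelDeriv_eq_fderiv]
    have h3 : fderiv ℝ (fun z : ℝ => z - t) t = ContinuousLinearMap.id ℝ ℝ := by
      rw [fderiv_sub_const]; exact fderiv_id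
    have h4 : α.toDual (K (t, f m))
        (modelDeriv 𝓘(ℝ, ℝ) 𝓘(ℝ, F) (fun z => K (z, K (t, f m))) 0 1) = 1 := by
      rw [MForm.toDual_apply]
      exact hα.normalized (K (t, f m))
    rw [h3, sub_self, ContinuousLinearMap.comp_id]
    have : s = s • (1 : ℝ) := by simp
    rw [this, map_smul, map_smul, h4]

/-- The logarithmic derivative `L` of a circle-valued map `w`: acting by `w` changes the pullback
of a connection form by `L`, whatever map is acted on, and `L = 0` only if `dw = 0`. -/
theorem exists_logDeriv (hα : IsConnectionForm α)
    (hact : ContMDiff ((𝓡 1).prod 𝓘(ℝ, F)) 𝓘(ℝ, F) ∞ (fun q : Circle × P => q.1 • q.2))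
    {w : M → Circle} {m : M} (hw : MDifferentiableAt I (𝓡 1) w m) :
    ∃ L : V →L[ℝ] ℝ,
      (∀ f : M → P, MDifferentiableAt I 𝓘(ℝ, F) f m →
        MForm.pullDual I α (fun x => w x • f x) m = MForm.pullDual I α f m + L) ∧
      (L = 0 → modelDeriv I 𝓘(ℝ, ℂ) (fun x => (w x : ℂ)) m = 0) := by
  obtain ⟨u, hu, hwu⟩ := exists_circle_log hw
  refine ⟨modelDeriv I 𝓘(ℝ, ℝ) u m, fun f hf => ?_, fun h0 => ?_⟩
  · have hz : MDifferentiableAt I 𝓘(ℝ, F) (fun x => w m • f x) m :=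
      MDifferentiableAt.comp m (g := fun q : Circle × P => q.1 • q.2) (f := fun x => (w m, f x))
        ((hact (w m, f m)).mdifferentiableAt (by simp)) (mdifferentiableAt_const.prodMk hf)
    have : (fun x => w x • f x) = fun x => Circle.exp (2 * Real.pi * u x) • (w m • f x) := by
      ext x; rw [smul_smul, ← hwu]
    rw [this, hα.pullDual_exp_smul hact hu hz, hα.pullDual_const_smul hact _ hf]
  · let κ : ℝ → ℂ := fun t => Complex.exp ((2 * Real.pi * t : ℝ) * Complex.I) * (w m : ℂ)
    have hκ : Differentiable ℝ κ := by
      intro t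
      have : DifferentiableAt ℝ (fun t : ℝ => ((2 * Real.pi * t : ℝ) : ℂ)) t :=
        Complex.ofRealCLM.differentiableAt.comp t (differentiableAt_id.const_mul _)
      exact ((this.mul_const _).cexp).mul_const _
    have : (fun x => (w x : ℂ)) = fun x => κ (u x) := by
      ext x
      rw [hwu x, Circle.coe_mul, Circle.coe_exp]
    rw [this, modelDeriv_comp (hκ (u m)).mdifferentiableAt hu, h0, ContinuousLinearMap.comp_zero]

end IsConnectionForm

namespace IsPrincipalCircleBundle

variable {E : Type*} [NormedAddCommGroup E] [NormedSpace ℝ E]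
  {B : Type*} [TopologicalSpace B] [ChartedSpace E B] {π : P → B}
  {G : Type*} [NormedAddCommGroup G] [NormedSpace ℝ G]

theorem mdifferentiableAt_smul (hπ : IsPrincipalCircleBundle F E π) {w : M → Circle} {f : M → P}
    {m : M} (hw : MDifferentiableAt I (𝓡 1) w m) (hf : MDifferentiableAt I 𝓘(ℝ, F) f m) :
    MDifferentiableAt I 𝓘(ℝ, F) (fun x => w x • f x) m :=
  MDifferentiableAt.comp m (g := fun q : Circle × P => q.1 • q.2) (f := fun x => (w x, f x))
    ((hπ.smooth_action (w m, f m)).mdifferentiableAt (by simp)) (hw.prodMk hf)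

theorem eq_one_of_smul_eq (hπ : IsPrincipalCircleBundle F E π) {z : Circle} {p : P}
    (h : z • p = p) : z = 1 := by
  obtain ⟨e, hb, -, -, he⟩ := hπ.locally_trivial (π p)
  have := he z p (e.mem_source.2 hb)
  rw [h] at this
  have := congrArg Prod.snd this
  simpa using this.symm

theorem smul_left_injective (hπ : IsPrincipalCircleBundle F E π) {z z' : Circle} {p : P}
    (h : z • p = z' • p) : z = z' := by
  have : (z'⁻¹ * z) • p = p := by rw [mul_smul, h, inv_smul_smul]
  exact (inv_mul_eq_one.1 (hπ.eq_one_of_smul_eq this)).symm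

/-- Two differentiable maps with the same projection differ locally by a differentiable
circle-valued map. -/
theorem exists_smul_eq_of_proj_eq (hπ : IsPrincipalCircleBundle F E π) {f₁ f₂ : M → P} {m : M}
    (h₁ : MDifferentiableAt I 𝓘(ℝ, F) f₁ m) (h₂ : MDifferentiableAt I 𝓘(ℝ, F) f₂ m)
    (h : ∀ᶠ x in 𝓝 m, π (f₁ x) = π (f₂ x)) :
    ∃ w : M → Circle, MDifferentiableAt I (𝓡 1) w m ∧ ∀ᶠ x in 𝓝 m, w x • f₁ x = f₂ x := by
  obtain ⟨e, hb, hes, -, he⟩ := hπ.locally_trivial (π (f₁ m))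
  have hm1 : f₁ m ∈ e.source := e.mem_source.2 hb
  have hm2 : f₂ m ∈ e.source := e.mem_source.2 (h.self_of_nhds ▸ hb)
  have hd : ∀ f : M → P, MDifferentiableAt I 𝓘(ℝ, F) f m → f m ∈ e.source →
      MDifferentiableAt I (𝓡 1) (fun x => (e (f x)).2) m := by
    intro f hf hs
    have h3 : MDifferentiableAt 𝓘(ℝ, F) (𝓘(ℝ, E).prod (𝓡 1)) e (f m) :=
      (hes.contMDiffAt (e.open_source.mem_nhds hs)).mdifferentiableAt (by simp)
    exact (mdifferentiableAt_snd (I := 𝓘(ℝ, E))).comp m (h3.comp m hf)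
  refine ⟨fun x => (e (f₂ x)).2 * (e (f₁ x)).2⁻¹, ?_, ?_⟩
  · have h5 : ContMDiff ((𝓡 1).prod (𝓡 1)) (𝓡 1) ∞ fun q : Circle × Circle => q.1 * q.2⁻¹ :=
      contMDiff_fst.mul contMDiff_snd.inv
    exact ((h5 ((e (f₂ m)).2, (e (f₁ m)).2)).mdifferentiableAt (by simp)).comp m
      ((hd f₂ h₂ hm2).prodMk (hd f₁ h₁ hm1))
  · filter_upwards [h, h₁.continuousAt (e.open_source.mem_nhds hm1),
      h₂.continuousAt (e.open_source.mem_nhds hm2)] with x hx hx1 hx2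
    apply e.injOn _ hx2
    · refine (he _ _ hx1).trans ?_
      rw [inv_mul_cancel_right]
      refine Prod.ext ?_ rfl
      change (e (f₁ x)).1 = (e (f₂ x)).1
      rw [e.coe_fst hx1, e.coe_fst hx2, hx]
    · rw [mem_preimage] at hx1
      rw [e.mem_source, hπ.proj_smul]
      exact e.mem_source.1 hx1

theorem exists_smul_eq (hπ : IsPrincipalCircleBundle F E π) {p q : P} (h : π p = π q) :
    ∃ z : Circle, z • p = q := by
  obtain ⟨w, -, hw⟩ := hπ.exists_smul_eq_of_proj_eq (I := 𝓘(ℝ, ℝ)) (f₁ := fun _ : ℝ => p)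
    (f₂ := fun _ => q) (m := 0) mdifferentiableAt_const mdifferentiableAt_const (by simp [h])
  exact ⟨w 0, hw.self_of_nhds⟩

/-- Two lifts of the same map on a convex open set which pull back the connection form to the
same form differ by a constant element of the circle. -/
theorem exists_smul_eqOn_of_pullDual_eq (hπ : IsPrincipalCircleBundle F E π) {α : MForm F P 1}
    (hα : IsConnectionForm α) {O : Set G} (hO : IsOpen O) (hc : Convex ℝ O) {f₁ f₂ : G → P}
    (h₁ : ∀ x ∈ O, MDifferentiableAt 𝓘(ℝ, G) 𝓘(ℝ, F) f₁ x)
    (h₂ : ∀ x ∈ O, MDifferentiableAt 𝓘(ℝ, G) 𝓘(ℝ, F) f₂ x)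
    (hp : ∀ x ∈ O, π (f₁ x) = π (f₂ x))
    (hd : ∀ x ∈ O, MForm.pullDual 𝓘(ℝ, G) α f₁ x = MForm.pullDual 𝓘(ℝ, G) α f₂ x) :
    ∃ z : Circle, ∀ x ∈ O, z • f₁ x = f₂ x := by
  choose! w hw using fun x (hx : x ∈ O) => hπ.exists_smul_eq (hp x hx)
  have key : ∀ x ∈ O, HasFDerivAt (fun y => (w y : ℂ)) (0 : G →L[ℝ] ℂ) x := by
    intro x hx
    obtain ⟨w', hw', hs⟩ := hπ.exists_smul_eq_of_proj_eq (h₁ x hx) (h₂ x hx)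
      (by filter_upwards [hO.mem_nhds hx] with y hy using hp y hy)
    obtain ⟨L, hL, hL0⟩ := hα.exists_logDeriv hπ.smooth_action hw'
    have h0 : L = 0 := by
      have h3 := hL f₁ (h₁ x hx)
      rw [MForm.pullDual_congr α hs, hd x hx] at h3
      simpa using h3
    have h4 := hL0 h0
    have hdiff : DifferentiableAt ℝ (fun y => (w' y : ℂ)) x :=
      ((mdifferentiableAt_circle_coe (w' x)).comp x hw').differentiableAt
    rw [modelDeriv_eq_fderiv] at h4
    have h5 := hdiff.hasFDerivAt
    rw [h4] at h5
    refine h5.congr_of_eventuallyEq ?_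
    filter_upwards [hs, hO.mem_nhds hx] with y hy hyO
    rw [hπ.smul_left_injective ((hw y hyO).trans hy.symm)]
  rcases O.eq_empty_or_nonempty with rfl | ⟨x₀, hx₀⟩
  · exact ⟨1, by simp⟩
  refine ⟨w x₀, fun x hx => ?_⟩
  have : (w x : ℂ) = w x₀ := by
    refine hc.is_const_of_fderivWithin_eq_zero (𝕜 := ℝ) (f := fun y => (w y : ℂ))
      (fun y hy => (key y hy).differentiableAt.differentiableWithinAt) (fun y hy => ?_) hx hx₀
    rw [fderivWithin_of_isOpen hO hy, (key y hy).fderiv]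
  rw [← Circle.ext this, hw x hx]

theorem eqOn_of_pullDual_eq (hπ : IsPrincipalCircleBundle F E π) {α : MForm F P 1}
    (hα : IsConnectionForm α) {O : Set G} (hO : IsOpen O) (hc : Convex ℝ O) {f₁ f₂ : G → P}
    (h₁ : ∀ x ∈ O, MDifferentiableAt 𝓘(ℝ, G) 𝓘(ℝ, F) f₁ x)
    (h₂ : ∀ x ∈ O, MDifferentiableAt 𝓘(ℝ, G) 𝓘(ℝ, F) f₂ x)
    (hp : ∀ x ∈ O, π (f₁ x) = π (f₂ x))
    (hd : ∀ x ∈ O, MForm.pullDual 𝓘(ℝ, G) α f₁ x = MForm.pullDual 𝓘(ℝ, G) α f₂ x)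
    {x₀ : G} (hx₀ : x₀ ∈ O) (h0 : f₁ x₀ = f₂ x₀) : EqOn f₁ f₂ O := by
  obtain ⟨z, hz⟩ := hπ.exists_smul_eqOn_of_pullDual_eq hα hO hc h₁ h₂ hp hd
  have h1 : z = 1 := hπ.eq_one_of_smul_eq ((hz x₀ hx₀).trans h0.symm)
  intro x hx
  rw [← hz x hx, h1, one_smul]

end IsPrincipalCircleBundle

end CircleActions

/-! ### Torus actions and moment maps -/

section TorusActions

theorem torusExp_add {n : ℕ} (X Y : Fin n → ℝ) : torusExp (X + Y) = torusExp X * torusExp Y := by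
  ext1 j
  simp only [torusExp, Pi.add_apply, Pi.mul_apply, mul_add, Circle.exp_add]

theorem torusExp_zero {n : ℕ} : torusExp (0 : Fin n → ℝ) = 1 := by
  ext1 j
  simp [torusExp]

theorem torusExp_surjective {n : ℕ} : Function.Surjective (torusExp (n := n)) := by
  intro g
  refine ⟨fun j => (2 * Real.pi)⁻¹ * Complex.arg (g j), ?_⟩
  ext1 j
  have : 2 * Real.pi * ((2 * Real.pi)⁻¹ * Complex.arg (g j)) = Complex.arg (g j) := by
    have := Real.pi_ne_zero
    field_simp
  simp only [torusExp, this, Circle.exp_arg]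

variable {E : Type*} [NormedAddCommGroup E] [NormedSpace ℝ E]
  {M : Type*} [TopologicalSpace M] [ChartedSpace E M] {n : ℕ} [MulAction (Torus n) M]

variable (E) in
/-- The vector field induced by an element of the Lie algebra of the torus, as a map to the model
space. -/
noncomputable def modelField (X : Fin n → ℝ) (x : M) : E := inducedField E X x

namespace IsSmoothTorusAction

theorem mdifferentiableAt (h : IsSmoothTorusAction n E M) (q : (Fin n → ℝ) × M) :
    MDifferentiableAt (𝓘(ℝ, Fin n → ℝ).prod 𝓘(ℝ, E)) 𝓘(ℝ, E)
      (fun q : (Fin n → ℝ) × M => torusExp q.1 • q.2) q :=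
  (h q).mdifferentiableAt (by simp)

theorem mdifferentiableAt_left (h : IsSmoothTorusAction n E M) (Y : Fin n → ℝ) (x : M) :
    MDifferentiableAt 𝓘(ℝ, Fin n → ℝ) 𝓘(ℝ, E) (fun Z : Fin n → ℝ => torusExp Z • x) Y :=
  (h.mdifferentiableAt (Y, x)).comp Y (mdifferentiableAt_id.prodMk mdifferentiableAt_const)

theorem mdifferentiableAt_smul (h : IsSmoothTorusAction n E M) (g : Torus n) (x : M) :
    MDifferentiableAt 𝓘(ℝ, E) 𝓘(ℝ, E) (fun y : M => g • y) x := by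
  obtain ⟨Y, rfl⟩ := torusExp_surjective g
  exact (h.mdifferentiableAt (Y, x)).comp x (mdifferentiableAt_const.prodMk mdifferentiableAt_id)

theorem mdifferentiableAt_exp_smul (h : IsSmoothTorusAction n E M) (X : Fin n → ℝ) (x : M)
    (t : ℝ) : MDifferentiableAt 𝓘(ℝ, ℝ) 𝓘(ℝ, E) (fun t : ℝ => torusExp (t • X) • x) t := by
  have h1 : MDifferentiableAt 𝓘(ℝ, ℝ) 𝓘(ℝ, Fin n → ℝ) (fun t : ℝ => t • X) t :=
    ((differentiableAt_id (𝕜 := ℝ)).smul_const X).mdifferentiableAt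
  exact (h.mdifferentiableAt_left (t • X) x).comp t h1

theorem modelDeriv_exp (h : IsSmoothTorusAction n E M) (x : M) (X : Fin n → ℝ) :
    modelDeriv 𝓘(ℝ, Fin n → ℝ) 𝓘(ℝ, E) (fun Z : Fin n → ℝ => torusExp Z • x) 0 X =
      modelField E X x := by
  have h1 : DifferentiableAt ℝ (fun t : ℝ => t • X) 0 := by fun_prop
  have h2 := modelDeriv_comp (f := fun Z : Fin n → ℝ => torusExp Z • x)
    (g := fun t : ℝ => t • X) (m := 0)
    (h.mdifferentiableAt_left _ x) h1.mdifferentiableAt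
  have h3 := congrArg (fun L => L (1 : ℝ)) h2
  rw [modelDeriv_eq_fderiv] at h3
  refine Eq.trans ?_ h3.symm
  have h4 : fderiv ℝ (fun t : ℝ => t • X) 0 1 = X := by
    change fderiv ℝ (ContinuousLinearMap.toSpanSingleton ℝ X) 0 1 = X
    simp
  change _ = modelDeriv _ _ _ ((0 : ℝ) • X) (fderiv ℝ (fun t : ℝ => t • X) 0 1)
  rw [h4, zero_smul]

/-- The derivative of the action map at any point, in terms of the induced vector fields. -/
theorem modelDeriv_apply (h : IsSmoothTorusAction n E M) (Y : Fin n → ℝ) (x : M)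
    (X : Fin n → ℝ) (v : E) :
    modelDeriv (𝓘(ℝ, Fin n → ℝ).prod 𝓘(ℝ, E)) 𝓘(ℝ, E)
      (fun q : (Fin n → ℝ) × M => torusExp q.1 • q.2) (Y, x) (X, v) =
    modelDeriv 𝓘(ℝ, E) 𝓘(ℝ, E) (fun y : M => torusExp Y • y) x (modelField E X x + v) := by
  rw [modelDeriv_uncurry (h.mdifferentiableAt _), map_add, ← h.modelDeriv_exp]
  congr 1
  let c : (Fin n → ℝ) → M := fun Z => torusExp Z • x
  have h1 : c = fun Z => (fun y : M => torusExp Y • y) (c (Z - Y)) := by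
    ext Z
    simp only [c, smul_smul, ← torusExp_add, add_sub_cancel]
  have hc : ∀ Z, MDifferentiableAt 𝓘(ℝ, Fin n → ℝ) 𝓘(ℝ, E) c Z :=
    fun Z => h.mdifferentiableAt_left Z x
  have hd : DifferentiableAt ℝ (fun Z : Fin n → ℝ => Z - Y) Y := by fun_prop
  have h2 : modelDeriv 𝓘(ℝ, Fin n → ℝ) 𝓘(ℝ, E) c Y =
      (modelDeriv 𝓘(ℝ, E) 𝓘(ℝ, E) (fun y : M => torusExp Y • y) (c (Y - Y))).comp
        ((modelDeriv 𝓘(ℝ, Fin n → ℝ) 𝓘(ℝ, E) c (Y - Y)).comp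
          (fderiv ℝ (fun Z : Fin n → ℝ => Z - Y) Y)) := by
    rw [← modelDeriv_eq_fderiv, ← modelDeriv_comp (hc _) hd.mdifferentiableAt,
      ← modelDeriv_comp (f := fun y : M => torusExp Y • y) (g := fun Z => c (Z - Y))
        (h.mdifferentiableAt_smul _ _) ((hc _).comp Y hd.mdifferentiableAt), ← h1]
  change modelDeriv _ _ c Y X = _
  rw [h2, sub_self, fderiv_sub_const]
  simp [c, torusExp_zero]

end IsSmoothTorusAction

namespace IsHamiltonianTorusAction

variable {Ω : MForm E M 2} {Φ : M → ((Fin n → ℝ) →L[ℝ] ℝ)}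

theorem mdifferentiableAt_moment (h : IsHamiltonianTorusAction Ω Φ) (x : M) :
    MDifferentiableAt 𝓘(ℝ, E) 𝓘(ℝ, (Fin n → ℝ) →L[ℝ] ℝ) Φ x :=
  (h.smooth_moment x).mdifferentiableAt (by simp)

theorem modelDeriv_moment (h : IsHamiltonianTorusAction Ω Φ) (X : Fin n → ℝ) (x : M) (v : E) :
    modelDeriv 𝓘(ℝ, E) 𝓘(ℝ, (Fin n → ℝ) →L[ℝ] ℝ) Φ x v X =
      Ω.model x ![modelField E X x, v] := by
  rw [show Ω.model x ![modelField E X x, v] = modelDeriv 𝓘(ℝ, E) 𝓘(ℝ, ℝ)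
    (fun y : M => Φ y X) x v from (h.moment X x v).symm]
  let L : ((Fin n → ℝ) →L[ℝ] ℝ) →L[ℝ] ℝ := ContinuousLinearMap.apply ℝ ℝ X
  have := modelDeriv_comp (f := L) (g := Φ) (m := x) L.differentiableAt.mdifferentiableAt
    (h.mdifferentiableAt_moment x)
  change _ = modelDeriv 𝓘(ℝ, E) 𝓘(ℝ, ℝ) (fun y : M => L (Φ y)) x v
  rw [this, modelDeriv_eq_fderiv, L.fderiv]
  rfl

/-- The orbits are isotropic. -/
theorem form_inducedField (h : IsHamiltonianTorusAction Ω Φ) (X Y : Fin n → ℝ) (x : M) :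
    Ω.model x ![modelField E X x, modelField E Y x] = 0 := by
  rw [← h.modelDeriv_moment, ← h.smooth_action.modelDeriv_exp]
  have h1 := modelDeriv_comp (f := Φ) (g := fun Z : Fin n → ℝ => torusExp Z • x) (m := 0)
    (h.mdifferentiableAt_moment _) (h.smooth_action.mdifferentiableAt_left 0 x)
  have h2 : (fun Z : Fin n → ℝ => Φ (torusExp Z • x)) = fun _ => Φ x := by
    ext1 Z
    exact h.invariant _ _
  rw [h2, modelDeriv_const, torusExp_zero, one_smul] at h1
  have h3 := congrArg (fun L => L Y X) h1
  exact h3.symm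

theorem form_smul (h : IsHamiltonianTorusAction Ω Φ) (g : Torus n) (x : M) (v w : E) :
    Ω.model (g • x) ![modelDeriv 𝓘(ℝ, E) 𝓘(ℝ, E) (fun y : M => g • y) x v,
      modelDeriv 𝓘(ℝ, E) 𝓘(ℝ, E) (fun y : M => g • y) x w] = Ω.model x ![v, w] := by
  have h1 := congrArg (fun η : MForm E M 2 => η.model x ![v, w]) (h.symplectic g)
  refine Eq.trans ?_ h1
  change Ω.model (g • x) _ = Ω.model (g • x) _
  congr 1
  ext i; fin_cases i <;> rfl

theorem form_add_add (η : E [⋀^Fin 2]→L[ℝ] ℝ) (a b c d : E) :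
    η ![a + b, c + d] = η ![a, c] + η ![a, d] - η ![c, b] + η ![b, d] := by
  have h1 : ∀ a b c : E, η ![a + b, c] = η ![a, c] + η ![b, c] := fun a b c =>
    η.toAlternatingMap.map_vecCons_add ![c] a b
  have h2 : ∀ a b : E, η ![a, b] = - η ![b, a] := by
    intro a b
    have := η.toAlternatingMap.map_swap ![b, a] (i := 0) (j := 1) (by decide)
    refine Eq.trans ?_ this
    change η _ = η _
    congr 1
    ext i; fin_cases i <;> simp
  rw [h1, h2 a, h2 b (c + d), h1, h1, h2 c a, h2 d a, h2 d b]
  ring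

/-- The pullback of `Ω` along the action map `(Y, x) ↦ exp Y • x`, on vectors `(X, v)`. -/
theorem form_modelDeriv_action (h : IsHamiltonianTorusAction Ω Φ) (Y : Fin n → ℝ) (x : M)
    (X X' : Fin n → ℝ) (v v' : E) :
    Ω.model (torusExp Y • x)
      ![modelDeriv (𝓘(ℝ, Fin n → ℝ).prod 𝓘(ℝ, E)) 𝓘(ℝ, E)
          (fun q : (Fin n → ℝ) × M => torusExp q.1 • q.2) (Y, x) (X, v),
        modelDeriv (𝓘(ℝ, Fin n → ℝ).prod 𝓘(ℝ, E)) 𝓘(ℝ, E)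
          (fun q : (Fin n → ℝ) × M => torusExp q.1 • q.2) (Y, x) (X', v')] =
      modelDeriv 𝓘(ℝ, E) 𝓘(ℝ, (Fin n → ℝ) →L[ℝ] ℝ) Φ x v' X -
        modelDeriv 𝓘(ℝ, E) 𝓘(ℝ, (Fin n → ℝ) →L[ℝ] ℝ) Φ x v X' + Ω.model x ![v, v'] := by
  rw [h.smooth_action.modelDeriv_apply, h.smooth_action.modelDeriv_apply, h.form_smul,
    form_add_add, h.form_inducedField, h.modelDeriv_moment, h.modelDeriv_moment]
  ring

end IsHamiltonianTorusAction

end TorusActions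

/-! ### The closed form governing lifts of the action -/

section Potential

variable {F : Type*} [NormedAddCommGroup F] [NormedSpace ℝ F]
  {P : Type*} [TopologicalSpace P] [ChartedSpace F P] [IsManifold 𝓘(ℝ, F) ∞ P]
  {E : Type*} [NormedAddCommGroup E] [NormedSpace ℝ E]
  {B : Type*} [TopologicalSpace B] [ChartedSpace E B]
  {G : Type*} [NormedAddCommGroup G] [NormedSpace ℝ G]
  {W : Type*} [NormedAddCommGroup W] [NormedSpace ℝ W]
  {n : ℕ} [MulAction (Torus n) B]
  {α : MForm F P 1} {π : P → B} {Ω : MForm E B 2} {Φ : B → ((Fin n → ℝ) →L[ℝ] ℝ)}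

theorem MForm.IsSmooth.fderiv_pullDual_sub_of_d_eq (hα : α.IsSmooth)
    (hπ : ContMDiff 𝓘(ℝ, F) 𝓘(ℝ, E) ∞ π) (hcurv : α.d = MForm.pullback π Ω)
    {f : G → P} {O : Set G} (hO : IsOpen O) (hf : ContMDiffOn 𝓘(ℝ, G) 𝓘(ℝ, F) ∞ f O)
    {x : G} (hx : x ∈ O) (v w : G) :
    fderiv ℝ (MForm.pullDual 𝓘(ℝ, G) α f) x v w - fderiv ℝ (MForm.pullDual 𝓘(ℝ, G) α f) x w v =
      Ω.model (π (f x)) ![modelDeriv 𝓘(ℝ, G) 𝓘(ℝ, E) (fun y => π (f y)) x v,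
        modelDeriv 𝓘(ℝ, G) 𝓘(ℝ, E) (fun y => π (f y)) x w] := by
  rw [hα.fderiv_pullDual_sub hO hf hx, hcurv, modelDeriv_comp (f := π) (g := f)
    ((hπ _).mdifferentiableAt (by simp))
    ((hf.contMDiffAt (hO.mem_nhds hx)).mdifferentiableAt (by simp))]
  change Ω.model (π (f x)) _ = Ω.model (π (f x)) _
  congr 1
  ext i; fin_cases i <;> rfl

variable (α Φ) in
/-- For maps `f₀`, `f₁` lifting `(Y, y) ↦ τ y` and `(Y, y) ↦ exp Y • τ y`, this is the one-form
which has to be the differential of `g` for `exp (2πig) • f₁` to pull `α` back to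
`f₀^* α - (Φ - c) dY`. -/
noncomputable def momentDefect (c : (Fin n → ℝ) →L[ℝ] ℝ) (τ : W → B)
    (f₀ f₁ : (Fin n → ℝ) × W → P) (x : (Fin n → ℝ) × W) : (Fin n → ℝ) × W →L[ℝ] ℝ :=
  MForm.pullDual 𝓘(ℝ, (Fin n → ℝ) × W) α f₀ x - MForm.pullDual 𝓘(ℝ, (Fin n → ℝ) × W) α f₁ x -
    (Φ (τ x.2) - c).comp (ContinuousLinearMap.fst ℝ (Fin n → ℝ) W)

section

variable {c : (Fin n → ℝ) →L[ℝ] ℝ} {τ : W → B} {T : Set W}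
  {f₀ f₁ : (Fin n → ℝ) × W → P} {O : Set ((Fin n → ℝ) × W)}

theorem contDiffOn_moment_comp (hΦ : IsHamiltonianTorusAction Ω Φ)
    (hτ : ContMDiffOn 𝓘(ℝ, W) 𝓘(ℝ, E) ∞ τ T) : ContDiffOn ℝ ∞ (fun y => Φ (τ y) - c) T := by
  rw [← contMDiffOn_iff_contDiffOn]
  exact (hΦ.smooth_moment.comp_contMDiffOn hτ).sub contMDiffOn_const

theorem contDiffOn_moment_comp_fst (hΦ : IsHamiltonianTorusAction Ω Φ)
    (hτ : ContMDiffOn 𝓘(ℝ, W) 𝓘(ℝ, E) ∞ τ T) (hOT : ∀ x ∈ O, x.2 ∈ T) :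
    ContDiffOn ℝ ∞ (fun x : (Fin n → ℝ) × W =>
      (Φ (τ x.2) - c).comp (ContinuousLinearMap.fst ℝ (Fin n → ℝ) W)) O :=
  ((contDiffOn_moment_comp hΦ hτ).comp contDiffOn_snd hOT).clm_comp contDiffOn_const

theorem contDiffOn_momentDefect (hα : α.IsSmooth) (hΦ : IsHamiltonianTorusAction Ω Φ)
    (hτ : ContMDiffOn 𝓘(ℝ, W) 𝓘(ℝ, E) ∞ τ T) (hO : IsOpen O) (hOT : ∀ x ∈ O, x.2 ∈ T)
    (hf₀ : ContMDiffOn 𝓘(ℝ, (Fin n → ℝ) × W) 𝓘(ℝ, F) ∞ f₀ O)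
    (hf₁ : ContMDiffOn 𝓘(ℝ, (Fin n → ℝ) × W) 𝓘(ℝ, F) ∞ f₁ O) :
    ContDiffOn ℝ ∞ (momentDefect α Φ c τ f₀ f₁) O :=
  ((hα.contDiffOn_pullDual hO hf₀).sub (hα.contDiffOn_pullDual hO hf₁)).sub
    (contDiffOn_moment_comp_fst hΦ hτ hOT)

/-- The one-form `momentDefect` is closed: this is where the moment map equation and the invariance of the
symplectic form enter. -/
theorem fderiv_momentDefect_symm (hα : α.IsSmooth) (hπ : ContMDiff 𝓘(ℝ, F) 𝓘(ℝ, E) ∞ π)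
    (hcurv : α.d = MForm.pullback π Ω) (hΦ : IsHamiltonianTorusAction Ω Φ) (hT : IsOpen T)
    (hτ : ContMDiffOn 𝓘(ℝ, W) 𝓘(ℝ, E) ∞ τ T) (hO : IsOpen O) (hOT : ∀ x ∈ O, x.2 ∈ T)
    (hf₀ : ContMDiffOn 𝓘(ℝ, (Fin n → ℝ) × W) 𝓘(ℝ, F) ∞ f₀ O)
    (hf₁ : ContMDiffOn 𝓘(ℝ, (Fin n → ℝ) × W) 𝓘(ℝ, F) ∞ f₁ O)
    (h₀ : ∀ x ∈ O, π (f₀ x) = τ x.2) (h₁ : ∀ x ∈ O, π (f₁ x) = torusExp x.1 • τ x.2)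
    {x : (Fin n → ℝ) × W} (hx : x ∈ O) (v w : (Fin n → ℝ) × W) :
    fderiv ℝ (momentDefect α Φ c τ f₀ f₁) x v w = fderiv ℝ (momentDefect α Φ c τ f₀ f₁) x w v := by
  have hOx := hO.mem_nhds hx
  have hτd : MDifferentiableAt 𝓘(ℝ, W) 𝓘(ℝ, E) τ x.2 :=
    (hτ.contMDiffAt (hT.mem_nhds (hOT x hx))).mdifferentiableAt (by simp)
  have hsnd : MDifferentiableAt 𝓘(ℝ, (Fin n → ℝ) × W) 𝓘(ℝ, W)
      (fun y : (Fin n → ℝ) × W => y.2) x := differentiableAt_snd.mdifferentiableAt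
  have hfst : MDifferentiableAt 𝓘(ℝ, (Fin n → ℝ) × W) 𝓘(ℝ, Fin n → ℝ)
      (fun y : (Fin n → ℝ) × W => y.1) x := differentiableAt_fst.mdifferentiableAt
  have hτs : MDifferentiableAt 𝓘(ℝ, (Fin n → ℝ) × W) 𝓘(ℝ, E)
      (fun y : (Fin n → ℝ) × W => τ y.2) x := hτd.comp x hsnd
  set D := modelDeriv 𝓘(ℝ, W) 𝓘(ℝ, E) τ x.2
  have hDs : modelDeriv 𝓘(ℝ, (Fin n → ℝ) × W) 𝓘(ℝ, E)
      (fun y : (Fin n → ℝ) × W => τ y.2) x = D.comp (ContinuousLinearMap.snd ℝ _ _) := by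
    rw [modelDeriv_comp (f := τ) (g := fun y : (Fin n → ℝ) × W => y.2) hτd hsnd,
      modelDeriv_eq_fderiv, fderiv_snd]
  -- the curvature of the two lifts
  have e0 := hα.fderiv_pullDual_sub_of_d_eq hπ hcurv hO hf₀ hx v w
  have e1 := hα.fderiv_pullDual_sub_of_d_eq hπ hcurv hO hf₁ hx v w
  rw [h₀ x hx, modelDeriv_congr (g := fun y : (Fin n → ℝ) × W => τ y.2)
    (by filter_upwards [hOx] with y hy using h₀ y hy), hDs] at e0
  rw [h₁ x hx, modelDeriv_congr (g := fun y : (Fin n → ℝ) × W => torusExp y.1 • τ y.2)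
    (by filter_upwards [hOx] with y hy using h₁ y hy),
    modelDeriv_comp (f := fun q : (Fin n → ℝ) × B => torusExp q.1 • q.2)
      (g := fun y : (Fin n → ℝ) × W => (y.1, τ y.2)) (hΦ.smooth_action.mdifferentiableAt _)
      (hfst.prodMk hτs), modelDeriv_prodMk hfst hτs, hDs, modelDeriv_eq_fderiv, fderiv_fst] at e1
  have e1' := e1.trans (hΦ.form_modelDeriv_action x.1 (τ x.2) v.1 w.1 (D v.2) (D w.2))
  -- the derivative of the moment map term
  have hξ : DifferentiableAt ℝ (fun y => Φ (τ y) - c) x.2 :=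
    ((contDiffOn_moment_comp hΦ hτ).contDiffAt (hT.mem_nhds (hOT x hx))).differentiableAt (by simp)
  have hξ' : fderiv ℝ (fun y => Φ (τ y) - c) x.2 =
      (modelDeriv 𝓘(ℝ, E) 𝓘(ℝ, (Fin n → ℝ) →L[ℝ] ℝ) Φ (τ x.2)).comp D := by
    rw [fderiv_sub_const, ← modelDeriv_eq_fderiv,
      modelDeriv_comp (f := Φ) (g := τ) (hΦ.mdifferentiableAt_moment _) hτd]
  have eκ : ∀ v w : (Fin n → ℝ) × W, fderiv ℝ (fun x : (Fin n → ℝ) × W =>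
      (Φ (τ x.2) - c).comp (ContinuousLinearMap.fst ℝ (Fin n → ℝ) W)) x v w =
      modelDeriv 𝓘(ℝ, E) 𝓘(ℝ, (Fin n → ℝ) →L[ℝ] ℝ) Φ (τ x.2) (D v.2) w.1 := by
    intro v w
    have hs : HasFDerivAt (fun x : (Fin n → ℝ) × W => Φ (τ x.2) - c)
        ((fderiv ℝ (fun y => Φ (τ y) - c) x.2).comp (ContinuousLinearMap.snd ℝ _ _)) x :=
      hξ.hasFDerivAt.comp x hasFDerivAt_snd
    rw [(hs.clm_comp (hasFDerivAt_const _ _)).fderiv, hξ']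
    simp
  have d0 := ((hα.contDiffOn_pullDual hO hf₀).contDiffAt hOx).differentiableAt (by simp)
  have d1 := ((hα.contDiffOn_pullDual hO hf₁).contDiffAt hOx).differentiableAt (by simp)
  have d2 : DifferentiableAt ℝ (fun x : (Fin n → ℝ) × W =>
      (Φ (τ x.2) - c).comp (ContinuousLinearMap.fst ℝ (Fin n → ℝ) W)) x :=
    ((contDiffOn_moment_comp_fst hΦ hτ hOT).contDiffAt hOx).differentiableAt (by simp)
  have hfd : fderiv ℝ (momentDefect α Φ c τ f₀ f₁) x =
      fderiv ℝ (MForm.pullDual 𝓘(ℝ, (Fin n → ℝ) × W) α f₀) x -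
      fderiv ℝ (MForm.pullDual 𝓘(ℝ, (Fin n → ℝ) × W) α f₁) x -
      fderiv ℝ (fun x : (Fin n → ℝ) × W =>
        (Φ (τ x.2) - c).comp (ContinuousLinearMap.fst ℝ (Fin n → ℝ) W)) x :=
    ((d0.hasFDerivAt.sub d1.hasFDerivAt).sub d2.hasFDerivAt).fderiv
  simp only [hfd, sub_apply, eκ]
  have e0' : fderiv ℝ (MForm.pullDual 𝓘(ℝ, (Fin n → ℝ) × W) α f₀) x v w -
      fderiv ℝ (MForm.pullDual 𝓘(ℝ, (Fin n → ℝ) × W) α f₀) x w v =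
      Ω.model (τ x.2) ![D v.2, D w.2] := e0
  linarith

theorem exists_momentDefect_potential (hα : α.IsSmooth) (hπ : ContMDiff 𝓘(ℝ, F) 𝓘(ℝ, E) ∞ π)
    (hcurv : α.d = MForm.pullback π Ω) (hΦ : IsHamiltonianTorusAction Ω Φ) (hT : IsOpen T)
    (hτ : ContMDiffOn 𝓘(ℝ, W) 𝓘(ℝ, E) ∞ τ T) (hO : IsOpen O) (hc : Convex ℝ O)
    (hOT : ∀ x ∈ O, x.2 ∈ T)
    (hf₀ : ContMDiffOn 𝓘(ℝ, (Fin n → ℝ) × W) 𝓘(ℝ, F) ∞ f₀ O)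
    (hf₁ : ContMDiffOn 𝓘(ℝ, (Fin n → ℝ) × W) 𝓘(ℝ, F) ∞ f₁ O)
    (h₀ : ∀ x ∈ O, π (f₀ x) = τ x.2) (h₁ : ∀ x ∈ O, π (f₁ x) = torusExp x.1 • τ x.2) :
    ∃ g : (Fin n → ℝ) × W → ℝ, ContDiffOn ℝ ∞ g O ∧
      ∀ x ∈ O, HasFDerivAt g (momentDefect α Φ c τ f₀ f₁ x) x := by
  have hs := contDiffOn_momentDefect (c := c) hα hΦ hτ hO hOT hf₀ hf₁
  obtain ⟨g, hg⟩ := hc.exists_forall_hasFDerivAt_of_fderiv_symmetric hO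
    (hs.differentiableOn (by simp)) fun x hx v w =>
      fderiv_momentDefect_symm hα hπ hcurv hΦ hT hτ hO hOT hf₀ hf₁ h₀ h₁ hx v w
  refine ⟨g, ?_, hg⟩
  rw [contDiffOn_infty_iff_fderiv_of_isOpen hO]
  exact ⟨fun x hx => (hg x hx).differentiableAt.differentiableWithinAt,
    hs.congr fun x hx => (hg x hx).fderiv⟩

end

end Potential

/-! ### Local lifts -/

section LocalLift

variable {F : Type*} [NormedAddCommGroup F] [NormedSpace ℝ F]
  {P : Type*} [TopologicalSpace P] [ChartedSpace F P] [MulAction Circle P]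
  {E : Type*} [NormedAddCommGroup E] [NormedSpace ℝ E]
  {B : Type*} [TopologicalSpace B] [ChartedSpace E B]
  {n : ℕ} [MulAction (Torus n) B]
  {α : MForm F P 1} {π : P → B} {Ω : MForm E B 2} {Φ : B → ((Fin n → ℝ) →L[ℝ] ℝ)}

namespace IsPrincipalCircleBundle

/-- A principal circle bundle has a local section near each point, together with the circle-valued
coordinate which expresses nearby points through the section. -/
theorem exists_local_section (hπ : IsPrincipalCircleBundle F E π) (b : B) :
    ∃ (U : Set B) (s : B → P) (z : P → Circle), IsOpen U ∧ b ∈ U ∧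
      ContMDiffOn 𝓘(ℝ, E) 𝓘(ℝ, F) ∞ s U ∧ (∀ x ∈ U, π (s x) = x) ∧
      ContMDiffOn 𝓘(ℝ, F) (𝓡 1) ∞ z (π ⁻¹' U) ∧ (∀ p, π p ∈ U → z p • s (π p) = p) ∧
      ∀ w p, π p ∈ U → z (w • p) = w * z p := by
  obtain ⟨e, hb, hes, het, he⟩ := hπ.locally_trivial b
  have hproj : ∀ x ∈ e.baseSet, π (e.toOpenPartialHomeomorph.symm (x, 1)) = x :=
    fun x hx => e.proj_symm_apply' hx
  refine ⟨e.baseSet, fun x => e.toOpenPartialHomeomorph.symm (x, 1), fun p => (e p).2,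
    e.open_baseSet, hb, ?_, hproj, ?_, ?_, ?_⟩
  · exact het.comp (contMDiff_id.prodMk contMDiff_const).contMDiffOn
      fun x hx => e.mem_target.2 hx
  · rw [← e.source_eq]
    exact contMDiff_snd.comp_contMDiffOn hes
  · intro p hp
    have hs : e.toOpenPartialHomeomorph.symm (π p, 1) ∈ e.source :=
      e.mem_source.2 (by rwa [hproj _ hp])
    have hp' : p ∈ e.source := e.mem_source.2 hp
    refine e.injOn (e.mem_source.2 (by rwa [hπ.proj_smul, hproj _ hp])) hp' ?_
    refine (he _ _ hs).trans ?_
    rw [e.apply_symm_apply' hp, mul_one]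
    exact e.mk_proj_snd hp'
  · intro w p hp
    exact congrArg Prod.snd (he w p (e.mem_source.2 hp))

end IsPrincipalCircleBundle

variable (α π Φ) in
/-- `ψ` is, for `Y` in the ball of radius `ε` and over the subset `U` of the base, a smooth family
`p ↦ ψ (Y, p)` of equivariant lifts of the diffeomorphisms `b ↦ exp Y • b`, which is the
identity for `Y = 0` and satisfies `ψ^* α = α - (Φ ∘ π - c) dY` as a form in `(Y, p)`. -/
structure IsMomentLift (c : (Fin n → ℝ) →L[ℝ] ℝ) (ε : ℝ) (U : Set B)
    (ψ : (Fin n → ℝ) × P → P) : Prop where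
  contMDiffOn : ContMDiffOn (𝓘(ℝ, Fin n → ℝ).prod 𝓘(ℝ, F)) 𝓘(ℝ, F) ∞ ψ
    (Metric.ball 0 ε ×ˢ (π ⁻¹' U))
  zero : ∀ p, π p ∈ U → ψ (0, p) = p
  proj : ∀ Y ∈ Metric.ball (0 : Fin n → ℝ) ε, ∀ p, π p ∈ U → π (ψ (Y, p)) = torusExp Y • π p
  smul : ∀ (z : Circle), ∀ Y ∈ Metric.ball (0 : Fin n → ℝ) ε, ∀ p, π p ∈ U →
    ψ (Y, z • p) = z • ψ (Y, p)
  pullDual_eq : ∀ Y ∈ Metric.ball (0 : Fin n → ℝ) ε, ∀ p, π p ∈ U →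
    MForm.pullDual (𝓘(ℝ, Fin n → ℝ).prod 𝓘(ℝ, F)) α ψ (Y, p) =
      (α.toDual p).comp (ContinuousLinearMap.snd ℝ (Fin n → ℝ) F) -
        (Φ (π p) - c).comp (ContinuousLinearMap.fst ℝ (Fin n → ℝ) F)

theorem exists_isMomentLift_nhds [IsManifold 𝓘(ℝ, F) ∞ P] [IsManifold 𝓘(ℝ, E) ∞ B]
    (hπ : IsPrincipalCircleBundle F E π) (hα : IsConnectionForm α)
    (hcurv : α.d = MForm.pullback π Ω) (hΦ : IsHamiltonianTorusAction Ω Φ)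
    (c : (Fin n → ℝ) →L[ℝ] ℝ) (b : B) :
    ∃ ε > 0, ∃ U, IsOpen U ∧ b ∈ U ∧ ∃ ψ, IsMomentLift α π Φ c ε U ψ := by
  obtain ⟨U, s, z, hU, hbU, hs, hπs, hz, hzs, hzm⟩ := hπ.exists_local_section b
  set φ := extChartAt 𝓘(ℝ, E) b with hφ
  let τ : E → B := fun y => φ.symm y
  set T : Set E := φ.target ∩ τ ⁻¹' U
  have hTo : IsOpen T :=
    (continuousOn_extChartAt_symm b).isOpen_inter_preimage (isOpen_extChartAt_target b) hU
  have hτ : ContMDiffOn 𝓘(ℝ, E) 𝓘(ℝ, E) ∞ τ T :=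
    (contMDiffOn_extChartAt_symm b).mono inter_subset_left
  let act : (Fin n → ℝ) × E → B := fun q => torusExp q.1 • τ q.2
  have hact : ContMDiffOn 𝓘(ℝ, (Fin n → ℝ) × E) 𝓘(ℝ, E) ∞ act (univ ×ˢ T) := by
    refine ContMDiff.comp_contMDiffOn (g := fun q : (Fin n → ℝ) × B => torusExp q.1 • q.2)
      (f := fun q : (Fin n → ℝ) × E => (q.1, τ q.2)) hΦ.smooth_action ?_
    exact contDiff_fst.contMDiff.contMDiffOn.prodMk
      (hτ.comp contDiff_snd.contMDiff.contMDiffOn fun q hq => hq.2)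
  -- the domain where both `b` and `exp Y • b` stay over the section
  set D : Set ((Fin n → ℝ) × E) := (univ ×ˢ T) ∩ act ⁻¹' U
  have hDo : IsOpen D := hact.continuousOn.isOpen_inter_preimage (isOpen_univ.prod hTo) hU
  have hbφ : φ b ∈ φ.target := mem_extChartAt_target b
  have hτb : τ (φ b) = b := φ.left_inv (mem_extChartAt_source b)
  have hbT : φ b ∈ T := ⟨hbφ, by rw [mem_preimage, hτb]; exact hbU⟩
  have hbD : ((0 : Fin n → ℝ), φ b) ∈ D := by
    refine ⟨⟨mem_univ _, hbT⟩, ?_⟩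
    simp only [act, mem_preimage, torusExp_zero, one_smul, hτb, hbU]
  obtain ⟨ρ, hρ, hball⟩ := Metric.isOpen_iff.1 hDo _ hbD
  set O := Metric.ball ((0 : Fin n → ℝ), φ b) ρ with hOdef
  have hOo : IsOpen O := Metric.isOpen_ball
  have hOT : ∀ x ∈ O, x.2 ∈ T := fun x hx => (hball hx).1.2
  let f₀ : (Fin n → ℝ) × E → P := fun q => s (τ q.2)
  let f₁ : (Fin n → ℝ) × E → P := fun q => s (act q)
  have hf₀ : ContMDiffOn 𝓘(ℝ, (Fin n → ℝ) × E) 𝓘(ℝ, F) ∞ f₀ O :=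
    hs.comp (hτ.comp contDiff_snd.contMDiff.contMDiffOn fun q hq => hOT q hq)
      fun q hq => (hOT q hq).2
  have hf₁ : ContMDiffOn 𝓘(ℝ, (Fin n → ℝ) × E) 𝓘(ℝ, F) ∞ f₁ O :=
    hs.comp (hact.mono fun q hq => (hball hq).1) fun q hq => (hball hq).2
  obtain ⟨g, hgs, hg⟩ := exists_momentDefect_potential (c := c) hα.smooth hπ.smooth_proj hcurv hΦ
    hTo hτ hOo (convex_ball _ _) hOT hf₀ hf₁ (fun x hx => hπs _ (hOT x hx).2)
    (fun x hx => hπs _ (hball hx).2)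
  -- at `Y = 0` the two lifts agree, so the potential is constant there
  have hprod : ∀ {Y y}, Y ∈ Metric.ball (0 : Fin n → ℝ) ρ → y ∈ Metric.ball (φ b) ρ →
      (Y, y) ∈ O := by
    intro Y y hY hy
    rw [hOdef, ← ball_prod_same]
    exact ⟨hY, hy⟩
  have h0ρ : (0 : Fin n → ℝ) ∈ Metric.ball (0 : Fin n → ℝ) ρ := Metric.mem_ball_self hρ
  have hg0 : ∀ y ∈ Metric.ball (φ b) ρ, g (0, y) = g (0, φ b) := by
    have hder : ∀ y ∈ Metric.ball (φ b) ρ, HasFDerivAt (fun y => g (0, y)) (0 : E →L[ℝ] ℝ) y := by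
      intro y hy
      have hyO := hprod h0ρ hy
      have hi : HasFDerivAt (fun y : E => ((0 : Fin n → ℝ), y))
        (ContinuousLinearMap.inr ℝ (Fin n → ℝ) E) y := hasFDerivAt_prodMk_right _ _
      have h1 := (hg _ hyO).comp y hi
      have hpull : ∀ f : (Fin n → ℝ) × E → P,
          ContMDiffOn 𝓘(ℝ, (Fin n → ℝ) × E) 𝓘(ℝ, F) ∞ f O →
          (MForm.pullDual 𝓘(ℝ, (Fin n → ℝ) × E) α f (0, y)).comp
            (ContinuousLinearMap.inr ℝ (Fin n → ℝ) E) =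
            MForm.pullDual 𝓘(ℝ, E) α (fun y => f (0, y)) y := by
        intro f hf
        rw [MForm.pullDual_comp (f := f) (g := fun y : E => ((0 : Fin n → ℝ), y)) α
          ((hf.contMDiffAt (hOo.mem_nhds hyO)).mdifferentiableAt (by simp))
          hi.differentiableAt.mdifferentiableAt, modelDeriv_eq_fderiv, hi.fderiv]
      have h01 : (fun y : E => f₀ (0, y)) = fun y => f₁ (0, y) := by
        ext y
        simp only [f₀, f₁, act, torusExp_zero, one_smul]
      have h2 : (momentDefect α Φ c τ f₀ f₁ (0, y)).comp
          (ContinuousLinearMap.inr ℝ (Fin n → ℝ) E) = 0 := by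
        rw [momentDefect, ContinuousLinearMap.sub_comp, ContinuousLinearMap.sub_comp, hpull f₀ hf₀,
          hpull f₁ hf₁, h01, sub_self, ContinuousLinearMap.comp_assoc,
          ContinuousLinearMap.fst_comp_inr]
        simp
      rw [h2] at h1
      exact h1
    intro y hy
    refine (convex_ball (φ b) ρ).is_const_of_fderivWithin_eq_zero (𝕜 := ℝ)
      (f := fun y => g (0, y))
      (fun y hy => (hder y hy).differentiableAt.differentiableWithinAt) (fun y hy => ?_) hy
      (Metric.mem_ball_self hρ)
    rw [fderivWithin_of_isOpen Metric.isOpen_ball hy, (hder y hy).fderiv]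
  let u : (Fin n → ℝ) × P → ℝ := fun q => g (q.1, φ (π q.2)) - g (0, φ b)
  let k : (Fin n → ℝ) × P → P := fun q => s (torusExp q.1 • π q.2)
  set N := φ.source ∩ φ ⁻¹' Metric.ball (φ b) ρ
  have hτφ : ∀ x ∈ N, τ (φ x) = x := fun x hx => φ.left_inv hx.1
  have hNo : IsOpen N := isOpen_extChartAt_preimage' b Metric.isOpen_ball
  have hNU : ∀ x ∈ N, x ∈ U := by
    intro x hx
    have := (hOT _ (hprod h0ρ hx.2)).2
    rwa [mem_preimage, hτφ x hx] at this
  have hactU : ∀ Y ∈ Metric.ball (0 : Fin n → ℝ) ρ, ∀ x ∈ N, torusExp Y • x ∈ U := by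
    intro Y hY x hx
    have := (hball (hprod hY hx.2)).2
    simpa only [act, mem_preimage, hτφ x hx] using this
  set S : Set ((Fin n → ℝ) × P) := Metric.ball 0 ρ ×ˢ (π ⁻¹' N)
  have hSo : IsOpen S := Metric.isOpen_ball.prod (hNo.preimage hπ.smooth_proj.continuous)
  have hJ : ContMDiffOn (𝓘(ℝ, Fin n → ℝ).prod 𝓘(ℝ, F)) 𝓘(ℝ, (Fin n → ℝ) × E) ∞
      (fun q : (Fin n → ℝ) × P => (q.1, φ (π q.2))) S := by
    refine contMDiffOn_fst.prodMk_space ?_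
    refine (contMDiffOn_extChartAt (x := b)).comp
      ((hπ.smooth_proj.comp contMDiff_snd).contMDiffOn) fun q hq => ?_
    rw [← extChartAt_source 𝓘(ℝ, E)]
    exact hq.2.1
  have hus : ContMDiffOn (𝓘(ℝ, Fin n → ℝ).prod 𝓘(ℝ, F)) 𝓘(ℝ, ℝ) ∞ u S :=
    (hgs.contMDiffOn.comp hJ fun q hq => hprod hq.1 hq.2.2).sub contMDiffOn_const
  have hzS : ContMDiffOn (𝓘(ℝ, Fin n → ℝ).prod 𝓘(ℝ, F)) (𝓡 1) ∞
      (fun q : (Fin n → ℝ) × P => z q.2) S :=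
    hz.comp contMDiffOn_snd fun q hq => hNU _ hq.2
  have hkS : ContMDiffOn (𝓘(ℝ, Fin n → ℝ).prod 𝓘(ℝ, F)) 𝓘(ℝ, F) ∞ k S := by
    refine hs.comp (t := U) ?_ fun q hq => hactU _ hq.1 _ hq.2
    exact (hΦ.smooth_action.comp (contMDiff_fst.prodMk
      (hπ.smooth_proj.comp contMDiff_snd))).contMDiffOn
  have hzk : ContMDiffOn (𝓘(ℝ, Fin n → ℝ).prod 𝓘(ℝ, F)) 𝓘(ℝ, F) ∞
      (fun q => z q.2 • k q) S :=
    hπ.smooth_action.comp_contMDiffOn (hzS.prodMk hkS)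
  have hexp : ContMDiffOn (𝓘(ℝ, Fin n → ℝ).prod 𝓘(ℝ, F)) (𝓡 1) ∞
      (fun q => Circle.exp (2 * Real.pi * u q)) S := by
    have h1 : ContMDiff 𝓘(ℝ, ℝ) (𝓡 1) ∞ (fun t : ℝ => Circle.exp (2 * Real.pi * t)) :=
      contMDiff_circleExp.comp (contDiff_const.mul contDiff_id).contMDiff
    exact h1.comp_contMDiffOn hus
  refine ⟨ρ, hρ, N, hNo, ⟨mem_extChartAt_source b, Metric.mem_ball_self hρ⟩,
    fun q => Circle.exp (2 * Real.pi * u q) • (z q.2 • k q), ?_, ?_, ?_, ?_, ?_⟩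
  · exact hπ.smooth_action.comp_contMDiffOn (hexp.prodMk hzk)
  · intro p hp
    have h1 : u (0, p) = 0 := sub_eq_zero.2 (hg0 _ hp.2)
    simp only [h1, k, torusExp_zero, one_smul, mul_zero, Circle.exp_zero]
    exact hzs p (hNU _ hp)
  · intro Y hY p hp
    simp only [hπ.proj_smul, k]
    exact hπs _ (hactU Y hY _ hp)
  · intro w Y hY p hp
    simp only [u, k, hπ.proj_smul, hzm w p (hNU _ hp), smul_smul]
    rw [mul_left_comm]
  · intro Y hY p hp
    have hqS : (Y, p) ∈ S := ⟨hY, hp⟩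
    have hSn := hSo.mem_nhds hqS
    have hqO := hprod hY hp.2
    have hud := (hus.contMDiffAt hSn).mdifferentiableAt (by simp)
    have hzd := (hzS.contMDiffAt hSn).mdifferentiableAt (by simp)
    have hkd := (hkS.contMDiffAt hSn).mdifferentiableAt (by simp)
    have hzkd := (hzk.contMDiffAt hSn).mdifferentiableAt (by simp)
    have hJd := (hJ.contMDiffAt hSn).mdifferentiableAt (by simp)
    obtain ⟨L, hL, -⟩ := hα.exists_logDeriv hπ.smooth_action hzd
    rw [hα.pullDual_exp_smul hπ.smooth_action hud hzkd, hL k hkd]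
    -- express everything through the derivative of `J (Y, p) = (Y, φ (π p))`
    set J : (Fin n → ℝ) × P → (Fin n → ℝ) × E := fun q => (q.1, φ (π q.2)) with hJdef
    set J' := modelDeriv (𝓘(ℝ, Fin n → ℝ).prod 𝓘(ℝ, F)) 𝓘(ℝ, (Fin n → ℝ) × E) J (Y, p)
    have hf : ∀ f : (Fin n → ℝ) × E → P,
        ContMDiffOn 𝓘(ℝ, (Fin n → ℝ) × E) 𝓘(ℝ, F) ∞ f O → ∀ h : (Fin n → ℝ) × P → P,
        (∀ q ∈ S, h q = f (J q)) →
        MForm.pullDual (𝓘(ℝ, Fin n → ℝ).prod 𝓘(ℝ, F)) α h (Y, p) =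
          (MForm.pullDual 𝓘(ℝ, (Fin n → ℝ) × E) α f (J (Y, p))).comp J' := by
      intro f hf h hh
      rw [MForm.pullDual_congr (g := fun q => f (J q)) α
        (by filter_upwards [hSn] with q hq using hh q hq)]
      exact MForm.pullDual_comp α
        ((hf.contMDiffAt (hOo.mem_nhds hqO)).mdifferentiableAt (by simp)) hJd
    have hk1 := hf f₁ hf₁ k fun q hq => by
      simp only [k, f₁, act, hJdef, hτφ _ hq.2]
    let k₀ : (Fin n → ℝ) × P → P := fun q => s (π q.2)
    have hk0 := hf f₀ hf₀ k₀ fun q hq => by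
      simp only [k₀, f₀, hJdef, hτφ _ hq.2]
    have hk0d : MDifferentiableAt (𝓘(ℝ, Fin n → ℝ).prod 𝓘(ℝ, F)) 𝓘(ℝ, F) k₀ (Y, p) :=
      ((hs.contMDiffAt (hU.mem_nhds (hNU _ hp))).comp (Y, p)
        ((hπ.smooth_proj.comp contMDiff_snd) (Y, p))).mdifferentiableAt (by simp)
    have hsnd := hL k₀ hk0d
    rw [MForm.pullDual_congr (g := Prod.snd) α
      (by filter_upwards [hSn] with q hq using hzs _ (hNU _ hq.2))] at hsnd
    have hsnd' : MForm.pullDual (𝓘(ℝ, Fin n → ℝ).prod 𝓘(ℝ, F)) α Prod.snd (Y, p) =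
        (α.toDual p).comp (ContinuousLinearMap.snd ℝ (Fin n → ℝ) F) := by
      rw [MForm.pullDual, modelDeriv_snd]
    have hfst : (ContinuousLinearMap.fst ℝ (Fin n → ℝ) E).comp J' =
        ContinuousLinearMap.fst ℝ (Fin n → ℝ) F := by
      have h1 : MDifferentiableAt 𝓘(ℝ, (Fin n → ℝ) × E) 𝓘(ℝ, Fin n → ℝ)
        (fun x : (Fin n → ℝ) × E => x.1) (J (Y, p)) := differentiableAt_fst.mdifferentiableAt
      have h2 := modelDeriv_comp h1 hJd
      rw [modelDeriv_eq_fderiv, fderiv_fst] at h2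
      rw [← h2]
      exact modelDeriv_fst
    have hu' : modelDeriv (𝓘(ℝ, Fin n → ℝ).prod 𝓘(ℝ, F)) 𝓘(ℝ, ℝ) u (Y, p) =
        (momentDefect α Φ c τ f₀ f₁ (J (Y, p))).comp J' := by
      have h1 : HasFDerivAt (fun x => g x - g (0, φ b)) (momentDefect α Φ c τ f₀ f₁ (J (Y, p)))
        (J (Y, p)) := (hg _ hqO).sub_const _
      have h2 := modelDeriv_comp h1.differentiableAt.mdifferentiableAt hJd
      rw [modelDeriv_eq_fderiv, h1.fderiv] at h2
      exact h2
    have hτp : τ (J (Y, p)).2 = π p := hτφ _ hp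
    rw [hu', momentDefect, ContinuousLinearMap.sub_comp, ContinuousLinearMap.sub_comp, ← hk0,
      ← hk1, hτp, ContinuousLinearMap.comp_assoc, hfst, ← hsnd', hsnd]
    abel

end LocalLift

/-! ### Local homomorphisms, and lifts over the whole base -/

section LocalHomomorphisms

variable {V : Type*} [NormedAddCommGroup V] {ε : ℝ}

theorem exists_nat_norm_lt_mul (hε : 0 < ε) (Y : V) :
    ∃ N : ℕ, 0 < N ∧ ‖Y‖ < N * ε := by
  obtain ⟨N, hN⟩ := exists_nat_gt (‖Y‖ / ε)
  have h1 : ‖Y‖ < N * ε := (div_lt_iff₀ hε).1 hN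
  refine ⟨N, ?_, h1⟩
  rcases Nat.eq_zero_or_pos N with rfl | h
  · simp at h1; exact absurd h1 (not_lt.2 (norm_nonneg _))
  · exact h

variable [NormedSpace ℝ V]

theorem norm_inv_nat_smul_lt {N : ℕ} (hN : 0 < N) {Y : V} (h : ‖Y‖ < N * ε) :
    ‖(N : ℝ)⁻¹ • Y‖ < ε := by
  have hN' : (0 : ℝ) < N := Nat.cast_pos.2 hN
  rw [norm_smul, norm_inv, Real.norm_natCast]
  exact (inv_mul_lt_iff₀ hN').2 h

/-- A property which holds near zero and is stable under addition holds everywhere. -/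
theorem induction_on_small_add {Q : V → Prop} (hε : 0 < ε) (hs : ∀ Y, ‖Y‖ < ε → Q Y)
    (ha : ∀ Y Z, Q Y → Q Z → Q (Y + Z)) (Y : V) : Q Y := by
  obtain ⟨N, hN, hY⟩ := exists_nat_norm_lt_mul hε Y
  have h1 := hs _ (norm_inv_nat_smul_lt hN hY)
  have h2 : ∀ k : ℕ, Q (k • ((N : ℝ)⁻¹ • Y)) := by
    intro k
    induction k with
    | zero => rw [zero_smul]; exact hs _ (by simpa using hε)
    | succ k ih => rw [succ_nsmul]; exact ha _ _ ih h1
  have h3 := h2 N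
  rwa [← Nat.cast_smul_eq_nsmul ℝ, smul_inv_smul₀ (Nat.cast_ne_zero.2 hN.ne')] at h3

/-- A local homomorphism from a normed space to a monoid extends to a homomorphism. -/
theorem exists_extension_of_local_hom {A : Type*} [Monoid A] (hε : 0 < ε) {ψ : V → A}
    (h0 : ψ 0 = 1) (ha : ∀ Y Z, ‖Y‖ + ‖Z‖ < ε → ψ (Y + Z) = ψ Y * ψ Z) :
    ∃ Ψ : V → A, (∀ Y Z, Ψ (Y + Z) = Ψ Y * Ψ Z) ∧ ∀ Y, ‖Y‖ < ε → Ψ Y = ψ Y := by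
  have hpow : ∀ (k : ℕ) (Z : V), k * ‖Z‖ < ε → ψ (k • Z) = ψ Z ^ k := by
    intro k
    induction k with
    | zero => intro Z _; simp [h0]
    | succ k ih =>
      intro Z hZ
      have h1 : k * ‖Z‖ + ‖Z‖ < ε := by push_cast at hZ; linarith
      rw [succ_nsmul, ha _ _ ((add_le_add_left (norm_nsmul_le) _).trans_lt h1),
        ih Z (by linarith [norm_nonneg Z]), pow_succ]
  -- `ψ (Y / N) ^ N` is unchanged when the scale is refined, hence independent of the scale
  have href : ∀ (N K : ℕ) (Y : V), 0 < N → 0 < K → ‖Y‖ < N * ε →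
      ψ ((N : ℝ)⁻¹ • Y) ^ N = ψ (((N * K : ℕ) : ℝ)⁻¹ • Y) ^ (N * K) := by
    intro N K Y hN hK hY
    have hK' : (K : ℝ) ≠ 0 := Nat.cast_ne_zero.2 hK.ne'
    have h1 : (N : ℝ)⁻¹ • Y = K • (((N * K : ℕ) : ℝ)⁻¹ • Y) := by
      rw [← Nat.cast_smul_eq_nsmul ℝ, smul_smul]
      congr 1
      push_cast
      field_simp
    have h2 : (K : ℝ) * ‖((N * K : ℕ) : ℝ)⁻¹ • Y‖ < ε := by
      have h3 := norm_inv_nat_smul_lt hN hY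
      rwa [h1, ← Nat.cast_smul_eq_nsmul ℝ, norm_smul, Real.norm_natCast] at h3
    rw [h1, hpow K _ h2, ← pow_mul, mul_comm K N]
  have hwd : ∀ (N K : ℕ) (Y : V), 0 < N → 0 < K → ‖Y‖ < N * ε → ‖Y‖ < K * ε →
      ψ ((N : ℝ)⁻¹ • Y) ^ N = ψ ((K : ℝ)⁻¹ • Y) ^ K := by
    intro N K Y hN hK h1 h2
    rw [href N K Y hN hK h1, href K N Y hK hN h2, mul_comm K N]
  choose N hN hY using fun Y : V => exists_nat_norm_lt_mul hε Y
  refine ⟨fun Y => ψ ((N Y : ℝ)⁻¹ • Y) ^ N Y, fun Y Z => ?_, fun Y h => ?_⟩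
  -- on a common scale `1 / K` the values at `Y` and `Z` commute, since `Y + Z = Z + Y`
  · obtain ⟨K, hK, hKY⟩ := exists_nat_norm_lt_mul hε (‖Y‖ + ‖Z‖)
    rw [Real.norm_of_nonneg (add_nonneg (norm_nonneg Y) (norm_nonneg Z))] at hKY
    have hY' : ‖Y‖ < K * ε := by linarith [norm_nonneg Z]
    have hZ' : ‖Z‖ < K * ε := by linarith [norm_nonneg Y]
    have hYZ' : ‖Y + Z‖ < K * ε := (norm_add_le _ _).trans_lt hKY
    have hK' : (0 : ℝ) < K := Nat.cast_pos.2 hK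
    have hs : ‖(K : ℝ)⁻¹ • Y‖ + ‖(K : ℝ)⁻¹ • Z‖ < ε := by
      rw [norm_smul, norm_smul, ← mul_add, norm_inv, Real.norm_natCast]
      exact (inv_mul_lt_iff₀ hK').2 hKY
    have hcomm : Commute (ψ ((K : ℝ)⁻¹ • Y)) (ψ ((K : ℝ)⁻¹ • Z)) := by
      rw [Commute, SemiconjBy, ← ha _ _ hs, ← ha _ _ (by linarith), add_comm]
    simp only
    rw [hwd _ K _ (hN _) hK (hY _) hYZ', hwd _ K _ (hN _) hK (hY _) hY',
      hwd _ K _ (hN _) hK (hY _) hZ', smul_add, ha _ _ hs, hcomm.mul_pow]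
  · simp only
    rw [hwd _ 1 Y (hN _) one_pos (hY _) (by simpa using h)]
    simp

end LocalHomomorphisms

section GlobalLift

variable {F : Type*} [NormedAddCommGroup F] [NormedSpace ℝ F]
  {P : Type*} [TopologicalSpace P] [ChartedSpace F P] [MulAction Circle P]
  {E : Type*} [NormedAddCommGroup E] [NormedSpace ℝ E] {B : Type*} {n : ℕ} [MulAction (Torus n) B]
  {α : MForm F P 1} {π : P → B} {Φ : B → ((Fin n → ℝ) →L[ℝ] ℝ)}
  {c : (Fin n → ℝ) →L[ℝ] ℝ} {ε ε' : ℝ} {U U' : Set B} {ψ ψ' : (Fin n → ℝ) × P → P}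

namespace IsMomentLift

theorem mono (h : IsMomentLift α π Φ c ε U ψ) (hε : ε' ≤ ε) (hU : U' ⊆ U) :
    IsMomentLift α π Φ c ε' U' ψ where
  contMDiffOn := h.contMDiffOn.mono (prod_mono (Metric.ball_subset_ball hε) (preimage_mono hU))
  zero p hp := h.zero p (hU hp)
  proj Y hY p hp := h.proj Y (Metric.ball_subset_ball hε hY) p (hU hp)
  smul z Y hY p hp := h.smul z Y (Metric.ball_subset_ball hε hY) p (hU hp)
  pullDual_eq Y hY p hp := h.pullDual_eq Y (Metric.ball_subset_ball hε hY) p (hU hp)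

theorem proj_of_add (hε : 0 < ε) (h : IsMomentLift α π Φ c ε univ ψ)
    (hadd : ∀ Y Z p, ψ (Y + Z, p) = ψ (Y, ψ (Z, p))) (Y : Fin n → ℝ) :
    ∀ p, π (ψ (Y, p)) = torusExp Y • π p := by
  refine induction_on_small_add (Q := fun Y => ∀ p, π (ψ (Y, p)) = torusExp Y • π p) hε
    (fun Y hY p => h.proj Y (mem_ball_zero_iff.2 hY) p (mem_univ _)) (fun Y Z hY hZ p => ?_) Y
  rw [hadd, hY, hZ, torusExp_add, mul_smul]

theorem smul_of_add (hε : 0 < ε) (h : IsMomentLift α π Φ c ε univ ψ)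
    (hadd : ∀ Y Z p, ψ (Y + Z, p) = ψ (Y, ψ (Z, p))) (Y : Fin n → ℝ) :
    ∀ (z : Circle) p, ψ (Y, z • p) = z • ψ (Y, p) := by
  refine induction_on_small_add (Q := fun Y => ∀ (z : Circle) p, ψ (Y, z • p) = z • ψ (Y, p)) hε
    (fun Y hY z p => h.smul z Y (mem_ball_zero_iff.2 hY) p (mem_univ _))
    (fun Y Z hY hZ z p => ?_) Y
  rw [hadd, hZ, hY, ← hadd]

variable [TopologicalSpace B] [ChartedSpace E B]

theorem contMDiffAt (h : IsMomentLift α π Φ c ε U ψ) (hπ : Continuous π) (hU : IsOpen U)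
    {Y : Fin n → ℝ} (hY : Y ∈ Metric.ball (0 : Fin n → ℝ) ε) {p : P} (hp : π p ∈ U) :
    ContMDiffAt (𝓘(ℝ, Fin n → ℝ).prod 𝓘(ℝ, F)) 𝓘(ℝ, F) ∞ ψ (Y, p) :=
  h.contMDiffOn.contMDiffAt ((Metric.isOpen_ball.prod (hU.preimage hπ)).mem_nhds ⟨hY, hp⟩)

theorem mdifferentiableAt_left (h : IsMomentLift α π Φ c ε U ψ) (hπ : Continuous π)
    (hU : IsOpen U) {Y : Fin n → ℝ} (hY : Y ∈ Metric.ball (0 : Fin n → ℝ) ε) {p : P}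
    (hp : π p ∈ U) :
    MDifferentiableAt 𝓘(ℝ, Fin n → ℝ) 𝓘(ℝ, F) (fun Z => ψ (Z, p)) Y :=
  ((h.contMDiffAt hπ hU hY hp).mdifferentiableAt (by simp)).comp Y
    (mdifferentiableAt_id.prodMk mdifferentiableAt_const)

/-- Along `Y ↦ ψ (Y, p)` the connection form evaluates to the constant `c - Φ (π p)`. Together with
the projection this determines the map, which is how lifts are compared. -/
theorem pullDual_left (h : IsMomentLift α π Φ c ε U ψ) (hπ : Continuous π)
    (hU : IsOpen U) {Y : Fin n → ℝ} (hY : Y ∈ Metric.ball (0 : Fin n → ℝ) ε) {p : P}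
    (hp : π p ∈ U) :
    MForm.pullDual 𝓘(ℝ, Fin n → ℝ) α (fun Z => ψ (Z, p)) Y = c - Φ (π p) := by
  have hi : MDifferentiableAt 𝓘(ℝ, Fin n → ℝ) 𝓘(ℝ, Fin n → ℝ) (fun Z : Fin n → ℝ => Z) Y :=
    mdifferentiableAt_id
  have hc : MDifferentiableAt 𝓘(ℝ, Fin n → ℝ) 𝓘(ℝ, F) (fun _ : Fin n → ℝ => p) Y :=
    mdifferentiableAt_const
  rw [MForm.pullDual_comp (f := ψ) (g := fun Z : Fin n → ℝ => (Z, p)) α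
    ((h.contMDiffAt hπ hU hY hp).mdifferentiableAt (by simp)) (hi.prodMk hc),
    h.pullDual_eq Y hY p hp, modelDeriv_prodMk hi hc, modelDeriv_const, modelDeriv_id]
  ext v
  simp

/-- Two local lifts agree where both are defined. -/
theorem eqOn (hπ : IsPrincipalCircleBundle F E π) (hα : IsConnectionForm α)
    (h : IsMomentLift α π Φ c ε U ψ) (h' : IsMomentLift α π Φ c ε U' ψ')
    (hU : IsOpen U) (hU' : IsOpen U') {p : P} (hp : π p ∈ U) (hp' : π p ∈ U')
    {Y : Fin n → ℝ} (hY : Y ∈ Metric.ball (0 : Fin n → ℝ) ε) : ψ (Y, p) = ψ' (Y, p) := by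
  have hc := hπ.smooth_proj.continuous
  have hε : 0 < ε := Metric.pos_of_mem_ball hY
  refine hπ.eqOn_of_pullDual_eq hα Metric.isOpen_ball (convex_ball (0 : Fin n → ℝ) ε)
    (fun Z hZ => h.mdifferentiableAt_left hc hU hZ hp)
    (fun Z hZ => h'.mdifferentiableAt_left hc hU' hZ hp') (fun Z hZ => ?_) (fun Z hZ => ?_)
    (Metric.mem_ball_self hε) ?_ hY
  · rw [h.proj Z hZ p hp, h'.proj Z hZ p hp']
  · rw [h.pullDual_left hc hU hZ hp, h'.pullDual_left hc hU' hZ hp']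
  · rw [h.zero p hp, h'.zero p hp']

open Classical in
theorem union (hπ : IsPrincipalCircleBundle F E π) (hα : IsConnectionForm α)
    (h : IsMomentLift α π Φ c ε U ψ) (h' : IsMomentLift α π Φ c ε U' ψ')
    (hU : IsOpen U) (hU' : IsOpen U') :
    IsMomentLift α π Φ c ε (U ∪ U') (fun q => if π q.2 ∈ U then ψ q else ψ' q) := by
  have hc := hπ.smooth_proj.continuous
  set χ : (Fin n → ℝ) × P → P := fun q => if π q.2 ∈ U then ψ q else ψ' q with hχ
  have e : ∀ q : (Fin n → ℝ) × P, π q.2 ∈ U → χ q = ψ q := fun q hq => if_pos hq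
  have e' : ∀ q : (Fin n → ℝ) × P, q.1 ∈ Metric.ball (0 : Fin n → ℝ) ε → π q.2 ∈ U' →
      χ q = ψ' q := by
    intro q hq hq'
    by_cases hqU : π q.2 ∈ U
    · rw [e q hqU]; exact h.eqOn hπ hα h' hU hU' hqU hq' hq
    · exact if_neg hqU
  have n1 : ∀ Y ∈ Metric.ball (0 : Fin n → ℝ) ε, ∀ p, π p ∈ U → χ =ᶠ[𝓝 (Y, p)] ψ := by
    intro Y hY p hp
    filter_upwards [(Metric.isOpen_ball.prod (hU.preimage hc)).mem_nhds ⟨hY, hp⟩] with q hq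
    exact e q hq.2
  have n2 : ∀ Y ∈ Metric.ball (0 : Fin n → ℝ) ε, ∀ p, π p ∈ U' → χ =ᶠ[𝓝 (Y, p)] ψ' := by
    intro Y hY p hp
    filter_upwards [(Metric.isOpen_ball.prod (hU'.preimage hc)).mem_nhds ⟨hY, hp⟩] with q hq
    exact e' q hq.1 hq.2
  refine ⟨?_, ?_, ?_, ?_, ?_⟩
  · rintro ⟨Y, p⟩ ⟨hY, hp | hp⟩
    · exact ((h.contMDiffAt hc hU hY hp).congr_of_eventuallyEq (n1 Y hY p hp)).contMDiffWithinAt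
    · exact ((h'.contMDiffAt hc hU' hY hp).congr_of_eventuallyEq (n2 Y hY p hp)).contMDiffWithinAt
  · intro p hp
    by_cases hpU : π p ∈ U
    · rw [e _ hpU, h.zero p hpU]
    · rw [hχ]
      simp only [hpU, if_false]
      exact h'.zero p (hp.resolve_left hpU)
  · rintro Y hY p (hp | hp)
    · rw [e _ hp, h.proj Y hY p hp]
    · rw [e' _ hY hp, h'.proj Y hY p hp]
  · rintro z Y hY p (hp | hp)
    · have hz : π (z • p) ∈ U := by rwa [hπ.proj_smul]
      rw [e (Y, p) hp, e (Y, z • p) hz, h.smul z Y hY p hp]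
    · have hz : π (z • p) ∈ U' := by rwa [hπ.proj_smul]
      rw [e' (Y, p) hY hp, e' (Y, z • p) hY hz, h'.smul z Y hY p hp]
  · rintro Y hY p (hp | hp)
    · rw [MForm.pullDual_congr α (n1 Y hY p hp), h.pullDual_eq Y hY p hp]
    · rw [MForm.pullDual_congr α (n2 Y hY p hp), h'.pullDual_eq Y hY p hp]

/-- Both sides are lifts of `Y ↦ exp (Y + Z) • π p` with the same pullback of `α`, because the
moment map is constant on orbits. -/
theorem apply_add (hπ : IsPrincipalCircleBundle F E π) (hα : IsConnectionForm α)
    (h : IsMomentLift α π Φ c ε univ ψ) (hinv : ∀ (g : Torus n) b, Φ (g • b) = Φ b)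
    {Y Z : Fin n → ℝ} (hYZ : ‖Y‖ + ‖Z‖ < ε) (p : P) : ψ (Y + Z, p) = ψ (Y, ψ (Z, p)) := by
  have hc := hπ.smooth_proj.continuous
  have hZ : Z ∈ Metric.ball (0 : Fin n → ℝ) ε :=
    mem_ball_zero_iff.2 (by linarith [norm_nonneg Y])
  set O := Metric.ball (0 : Fin n → ℝ) ε ∩ Metric.ball (-Z) ε with hO
  have hOZ : ∀ X ∈ O, X + Z ∈ Metric.ball (0 : Fin n → ℝ) ε := by
    intro X hX
    have := hX.2
    rw [mem_ball_iff_norm, sub_neg_eq_add] at this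
    exact mem_ball_zero_iff.2 this
  have hadd : ∀ X : Fin n → ℝ, MDifferentiableAt 𝓘(ℝ, Fin n → ℝ) 𝓘(ℝ, Fin n → ℝ)
    (fun X => X + Z) X := fun X => (differentiableAt_id.add_const Z).mdifferentiableAt
  refine hπ.eqOn_of_pullDual_eq hα (O := O) (Metric.isOpen_ball.inter Metric.isOpen_ball)
    ((convex_ball _ _).inter (convex_ball _ _)) (f₁ := fun X => ψ (X + Z, p))
    (f₂ := fun X => ψ (X, ψ (Z, p))) (fun X hX => ?_)
    (fun X hX => h.mdifferentiableAt_left hc isOpen_univ hX.1 (mem_univ _)) (fun X hX => ?_)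
    (fun X hX => ?_) (x₀ := 0) ?_ ?_ ?_
  · exact MDifferentiableAt.comp (g := fun X => ψ (X, p)) (f := fun X => X + Z) X
      (h.mdifferentiableAt_left hc isOpen_univ (hOZ X hX) (mem_univ _)) (hadd X)
  · rw [h.proj _ (hOZ X hX) p (mem_univ _), h.proj X hX.1 _ (mem_univ _),
      h.proj Z hZ p (mem_univ _), smul_smul, torusExp_add]
  · have e1 : modelDeriv 𝓘(ℝ, Fin n → ℝ) 𝓘(ℝ, Fin n → ℝ) (fun X => X + Z) X =
        ContinuousLinearMap.id ℝ _ := by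
      rw [modelDeriv_eq_fderiv, fderiv_add_const]; exact fderiv_id
    rw [MForm.pullDual_comp (f := fun X => ψ (X, p)) (g := fun X => X + Z) α
      (h.mdifferentiableAt_left hc isOpen_univ (hOZ X hX) (mem_univ _)) (hadd X), e1,
      h.pullDual_left hc isOpen_univ (hOZ X hX) (mem_univ _),
      h.pullDual_left hc isOpen_univ hX.1 (mem_univ _), h.proj Z hZ p (mem_univ _), hinv,
      ContinuousLinearMap.comp_id]
  · refine ⟨Metric.mem_ball_self (Metric.pos_of_mem_ball hZ), ?_⟩
    rw [mem_ball_iff_norm]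
    simpa using mem_ball_zero_iff.1 hZ
  · simp only [zero_add]
    rw [h.zero _ (mem_univ _)]
  · refine ⟨mem_ball_zero_iff.2 (by linarith [norm_nonneg Z]), ?_⟩
    rw [mem_ball_iff_norm, sub_neg_eq_add]
    exact (norm_add_le _ _).trans_lt hYZ

/-- Over a point which is fixed by the torus, and whose moment is the normalizing constant, a
lift of the action is the identity. -/
theorem apply_of_fixed (hπ : IsPrincipalCircleBundle F E π) (hα : IsConnectionForm α)
    (h : IsMomentLift α π Φ c ε univ ψ) {p : P}
    (hfix : ∀ g : Torus n, g • π p = π p) (hcp : c = Φ (π p)) {Y : Fin n → ℝ}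
    (hY : Y ∈ Metric.ball (0 : Fin n → ℝ) ε) : ψ (Y, p) = p := by
  have hc := hπ.smooth_proj.continuous
  have hε : 0 < ε := Metric.pos_of_mem_ball hY
  refine hπ.eqOn_of_pullDual_eq hα Metric.isOpen_ball (convex_ball (0 : Fin n → ℝ) ε)
    (f₂ := fun _ => p)
    (fun Z hZ => h.mdifferentiableAt_left hc isOpen_univ hZ (mem_univ _))
    (fun Z hZ => mdifferentiableAt_const) (fun Z hZ => ?_) (fun Z hZ => ?_)
    (Metric.mem_ball_self hε) (h.zero p (mem_univ _)) hY
  · rw [h.proj Z hZ p (mem_univ _), hfix]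
  · rw [h.pullDual_left hc isOpen_univ hZ (mem_univ _), hcp, sub_self, MForm.pullDual,
      modelDeriv_const, ContinuousLinearMap.comp_zero]

end IsMomentLift

variable [TopologicalSpace B] [ChartedSpace E B] {Ω : MForm E B 2}

theorem exists_isMomentLift_univ [IsManifold 𝓘(ℝ, F) ∞ P] [IsManifold 𝓘(ℝ, E) ∞ B]
    [CompactSpace B] (hπ : IsPrincipalCircleBundle F E π) (hα : IsConnectionForm α)
    (hcurv : α.d = MForm.pullback π Ω) (hΦ : IsHamiltonianTorusAction Ω Φ)
    (c : (Fin n → ℝ) →L[ℝ] ℝ) :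
    ∃ ε > 0, ∃ ψ, IsMomentLift α π Φ c ε univ ψ := by
  suffices h : ∃ ε > 0, ∃ U, IsOpen U ∧ (univ : Set B) ⊆ U ∧ ∃ ψ, IsMomentLift α π Φ c ε U ψ by
    obtain ⟨ε, hε, U, -, hU, ψ, hψ⟩ := h
    exact ⟨ε, hε, ψ, hψ.mono le_rfl hU⟩
  refine isCompact_univ.induction_on (p := fun S : Set B =>
    ∃ ε > 0, ∃ U, IsOpen U ∧ S ⊆ U ∧ ∃ ψ, IsMomentLift α π Φ c ε U ψ) ?_ ?_ ?_ ?_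
  · refine ⟨1, one_pos, ∅, isOpen_empty, empty_subset _, fun q => q.2, ?_, ?_, ?_, ?_, ?_⟩ <;> simp
  · rintro S T hST ⟨ε, hε, U, hU, hTU, hψ⟩
    exact ⟨ε, hε, U, hU, hST.trans hTU, hψ⟩
  · rintro S T ⟨ε, hε, U, hU, hSU, ψ, hψ⟩ ⟨ε', hε', U', hU', hTU', ψ', hψ'⟩
    exact ⟨min ε ε', lt_min hε hε', U ∪ U', hU.union hU', union_subset_union hSU hTU', _,
      (hψ.mono (min_le_left _ _) subset_rfl).union hπ hα
        (hψ'.mono (min_le_right _ _) subset_rfl) hU hU'⟩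
  · intro b _
    obtain ⟨ε, hε, U, hU, hbU, hψ⟩ := exists_isMomentLift_nhds hπ hα hcurv hΦ c b
    exact ⟨U, mem_nhdsWithin_of_mem_nhds (hU.mem_nhds hbU), ε, hε, U, hU, subset_rfl, hψ⟩

end GlobalLift

/-! ### Existence of fixed points -/

section FixedPoint

theorem torusExp_add_intCast {n : ℕ} (Y : Fin n → ℝ) (m : Fin n → ℤ) :
    torusExp (fun j => Y j + m j) = torusExp Y := by
  ext1 j
  simp only [torusExp]
  rw [show 2 * Real.pi * (Y j + m j) = 2 * Real.pi * Y j + m j * (2 * Real.pi) by ring]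
  exact Circle.periodic_exp.int_mul (m j) _

/-- Some one-parameter subgroup of the torus is dense, by the Baire category theorem: the
directions whose one-parameter subgroup meets a given open set form a dense open set. -/
theorem exists_dense_torusExp_smul (n : ℕ) :
    ∃ X : Fin n → ℝ, Dense {Y : Fin n → ℝ | ∃ t : ℝ, torusExp Y = torusExp (t • X)} := by
  let A : Set (Fin n → ℝ) → Set (Fin n → ℝ) := fun U =>
    {X | ∃ t : ℝ, ∃ Y ∈ U, torusExp Y = torusExp (t • X)}
  let S : Set (Set (Fin n → ℝ)) := TopologicalSpace.countableBasis (Fin n → ℝ)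
  have hopen : ∀ U ∈ S, IsOpen (A U) := by
    intro U hU
    have hUo := TopologicalSpace.isOpen_of_mem_countableBasis hU
    rw [isOpen_iff_mem_nhds]
    rintro X₀ ⟨t, Y, hY, hYX⟩
    have hc : ContinuousAt (fun X : Fin n → ℝ => Y + (t • X - t • X₀)) X₀ := by fun_prop
    have h1 := hc (by simpa using hUo.mem_nhds hY)
    filter_upwards [h1] with X hX
    refine ⟨t, _, hX, ?_⟩
    rw [torusExp_add, hYX, ← torusExp_add, add_sub_cancel]
  have hdense : ∀ U ∈ S, Dense (A U) := by
    intro U hU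
    obtain ⟨Y, hY⟩ := TopologicalSpace.nonempty_of_mem_countableBasis hU
    rw [Metric.dense_iff]
    intro X₀ r hr
    obtain ⟨t, ht⟩ := exists_gt (1 / r)
    have ht0 : 0 < t := (one_div_pos.2 hr).trans ht
    -- a lattice translate of `Y` at distance at most `1` from `t • X₀`
    let m : Fin n → ℤ := fun j => ⌊t * X₀ j - Y j⌋
    refine ⟨fun j => t⁻¹ * (Y j + m j), ?_, t, Y, hY, ?_⟩
    · rw [Metric.mem_ball, dist_pi_lt_iff hr]
      intro j
      have h1 : |Y j + m j - t * X₀ j| ≤ 1 := by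
        rw [abs_le]
        have := Int.floor_le (t * X₀ j - Y j)
        have := Int.lt_floor_add_one (t * X₀ j - Y j)
        constructor <;> simp only [m] <;> linarith
      rw [Real.dist_eq, show t⁻¹ * (Y j + m j) - X₀ j = t⁻¹ * (Y j + m j - t * X₀ j) by
        field_simp, abs_mul, abs_of_pos (inv_pos.2 ht0), inv_mul_lt_iff₀ ht0]
      exact h1.trans_lt ((div_lt_iff₀ hr).1 ht)
    · rw [← torusExp_add_intCast Y m]
      congr 1
      ext j
      simp only [Pi.smul_apply, smul_eq_mul]
      field_simp
  obtain ⟨X, hX⟩ := (dense_biInter_of_isOpen hopen (TopologicalSpace.countable_countableBasis _)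
    hdense).nonempty
  refine ⟨X, ?_⟩
  rw [(TopologicalSpace.isBasis_countableBasis (Fin n → ℝ)).dense_iff]
  intro U hU _
  obtain ⟨t, Y, hY, h⟩ := mem_iInter₂.1 hX U hU
  exact ⟨Y, hY, t, h⟩

variable {E : Type*} [NormedAddCommGroup E] [NormedSpace ℝ E]
  {M : Type*} [TopologicalSpace M] [ChartedSpace E M] {n : ℕ} [MulAction (Torus n) M]

theorem modelDeriv_eq_zero_of_isLocalMax {f : M → ℝ} {x : M}
    (hf : MDifferentiableAt 𝓘(ℝ, E) 𝓘(ℝ, ℝ) f x) (hx : ∀ y, f y ≤ f x) :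
    modelDeriv 𝓘(ℝ, E) 𝓘(ℝ, ℝ) f x = 0 := by
  have h1 : HasFDerivWithinAt (fun y => f ((extChartAt 𝓘(ℝ, E) x).symm y))
      (modelDeriv 𝓘(ℝ, E) 𝓘(ℝ, ℝ) f x) (range 𝓘(ℝ, E)) (extChartAt 𝓘(ℝ, E) x x) :=
    hf.hasMFDerivAt.2
  rw [modelWithCornersSelf_coe, range_id, hasFDerivWithinAt_univ] at h1
  refine IsLocalMax.hasFDerivAt_eq_zero (Filter.Eventually.of_forall fun y => ?_) h1
  rw [extChartAt_to_inv]
  exact hx _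

theorem IsSmoothTorusAction.modelDeriv_exp_smul_eq_zero
    (h : IsSmoothTorusAction n E M) {X : Fin n → ℝ} {x : M} (hX : modelField E X x = 0) (t : ℝ) :
    modelDeriv 𝓘(ℝ, ℝ) 𝓘(ℝ, E) (fun t : ℝ => torusExp (t • X) • x) t = 0 := by
  have h1 : MDifferentiableAt 𝓘(ℝ, ℝ) 𝓘(ℝ, Fin n → ℝ) (fun t : ℝ => t • X) t :=
    ((differentiableAt_id (𝕜 := ℝ)).smul_const X).mdifferentiableAt
  have h2 : MDifferentiableAt 𝓘(ℝ, ℝ) 𝓘(ℝ, E) (fun _ : ℝ => x) t := mdifferentiableAt_const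
  have h4 : fderiv ℝ (fun t : ℝ => t • X) t = ContinuousLinearMap.toSpanSingleton ℝ X :=
    (ContinuousLinearMap.toSpanSingleton ℝ X).fderiv
  rw [modelDeriv_comp (f := fun q : (Fin n → ℝ) × M => torusExp q.1 • q.2)
      (g := fun t : ℝ => (t • X, x)) (h.mdifferentiableAt _) (h1.prodMk h2),
    modelDeriv_prodMk h1 h2, modelDeriv_const, modelDeriv_eq_fderiv, h4]
  ext
  rw [ContinuousLinearMap.comp_apply, ContinuousLinearMap.prod_apply, h.modelDeriv_apply,
    ContinuousLinearMap.toSpanSingleton_apply, one_smul, hX]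
  simp

/-- A zero of the vector field induced by `X` is fixed by the one-parameter subgroup of `X`. -/
theorem IsSmoothTorusAction.exp_smul_eq_of_inducedField_eq_zero [IsManifold 𝓘(ℝ, E) ∞ M]
    (h : IsSmoothTorusAction n E M) {X : Fin n → ℝ} {x : M} (hX : modelField E X x = 0) (t : ℝ) :
    torusExp (t • X) • x = x := by
  set γ : ℝ → M := fun t => torusExp (t • X) • x with hγ
  have hγ0 : γ 0 = x := by simp [hγ, torusExp_zero]
  have hγd : ∀ t, MDifferentiableAt 𝓘(ℝ, ℝ) 𝓘(ℝ, E) γ t := h.mdifferentiableAt_exp_smul X x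
  have hder : ∀ t, modelDeriv 𝓘(ℝ, ℝ) 𝓘(ℝ, E) γ t = 0 := h.modelDeriv_exp_smul_eq_zero hX
  set φ := extChartAt 𝓘(ℝ, E) x with hφ
  have hsrc : γ 0 ∈ φ.source := by rw [hγ0]; exact mem_extChartAt_source x
  obtain ⟨δ, hδ, hball⟩ := Metric.mem_nhds_iff.1
    ((hγd 0).continuousAt ((isOpen_extChartAt_source (I := 𝓘(ℝ, E)) x).mem_nhds hsrc))
  have hφγ : ∀ t ∈ Metric.ball (0 : ℝ) δ, HasFDerivAt (fun t => φ (γ t)) (0 : ℝ →L[ℝ] E) t := by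
    intro t ht
    have hφd : MDifferentiableAt 𝓘(ℝ, E) 𝓘(ℝ, E) φ (γ t) :=
      mdifferentiableAt_extChartAt (by rw [← extChartAt_source 𝓘(ℝ, E)]; exact hball ht)
    have h1 := modelDeriv_comp hφd (hγd t)
    rw [hder, ContinuousLinearMap.comp_zero, modelDeriv_eq_fderiv] at h1
    rw [← h1]
    exact (hφd.comp t (hγd t)).differentiableAt.hasFDerivAt
  have hsmall : ∀ t : ℝ, ‖t‖ < δ → γ t = x := by
    intro t ht
    have ht' : t ∈ Metric.ball (0 : ℝ) δ := mem_ball_zero_iff.2 ht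
    have h0' : (0 : ℝ) ∈ Metric.ball (0 : ℝ) δ := Metric.mem_ball_self hδ
    have h1 : φ (γ t) = φ (γ 0) :=
      (convex_ball (0 : ℝ) δ).is_const_of_fderivWithin_eq_zero (𝕜 := ℝ) (f := fun t => φ (γ t))
        (fun y hy => (hφγ y hy).differentiableAt.differentiableWithinAt)
        (fun y hy => by rw [fderivWithin_of_isOpen Metric.isOpen_ball hy, (hφγ y hy).fderiv])
        ht' h0'
    exact (φ.injOn (hball ht') (hball h0') h1).trans hγ0
  refine induction_on_small_add (Q := fun t : ℝ => γ t = x) hδ hsmall (fun s t hs ht => ?_) t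
  change torusExp ((s + t) • X) • x = x
  change torusExp (s • X) • x = x at hs
  change torusExp (t • X) • x = x at ht
  rw [add_smul, torusExp_add, mul_smul, ht, hs]

/-- A Hamiltonian torus action on a compact manifold has a fixed point: a maximum of `Φ^X`, for
`X` generating a dense one-parameter subgroup. -/
theorem IsHamiltonianTorusAction.fixedPoints_nonempty [IsManifold 𝓘(ℝ, E) ∞ M] [T2Space M]
    [CompactSpace M] [Nonempty M] {Ω : MForm E M 2} {Φ : M → ((Fin n → ℝ) →L[ℝ] ℝ)}
    (hΩ : IsSymplecticForm Ω) (h : IsHamiltonianTorusAction Ω Φ) :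
    (MulAction.fixedPoints (Torus n) M).Nonempty := by
  obtain ⟨X, hX⟩ := exists_dense_torusExp_smul n
  have hcont : Continuous fun y => Φ y X :=
    (ContinuousLinearMap.apply ℝ ℝ X).continuous.comp h.smooth_moment.continuous
  obtain ⟨b, -, hb⟩ := isCompact_univ.exists_isMaxOn univ_nonempty hcont.continuousOn
  have hd : MDifferentiableAt 𝓘(ℝ, E) 𝓘(ℝ, ℝ) (fun y => Φ y X) b :=
    ((ContinuousLinearMap.apply ℝ ℝ X).differentiableAt.mdifferentiableAt).comp b
      (h.mdifferentiableAt_moment b)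
  have h0 := modelDeriv_eq_zero_of_isLocalMax hd fun y => hb (mem_univ y)
  have hz : modelField E X b = 0 := by
    refine hΩ.nondegenerate b _ fun w => ?_
    refine (h.moment X b w).symm.trans ?_
    exact congrArg (fun L : E →L[ℝ] ℝ => L w) h0
  have hfix := h.smooth_action.exp_smul_eq_of_inducedField_eq_zero hz
  have hcl : IsClosed {Y : Fin n → ℝ | torusExp Y • b = b} :=
    isClosed_eq (h.smooth_action.continuous.comp (Continuous.prodMk_left b)) continuous_const
  have huniv : {Y : Fin n → ℝ | torusExp Y • b = b} = univ := by
    refine hcl.closure_eq.symm.trans (Dense.closure_eq (hX.mono ?_))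
    rintro Y ⟨t, ht⟩
    rw [mem_ofPred_eq, ht, hfix t]
  refine ⟨b, fun g => ?_⟩
  obtain ⟨Y, rfl⟩ := torusExp_surjective g
  exact huniv.symm.subset (mem_univ Y)

end FixedPoint

/-! ### The lifted torus action -/

section LiftedAction

variable {F : Type*} [NormedAddCommGroup F] [NormedSpace ℝ F]
  {P : Type*} [TopologicalSpace P] [ChartedSpace F P] [MulAction Circle P]
  {E : Type*} [NormedAddCommGroup E] [NormedSpace ℝ E]
  {B : Type*} [TopologicalSpace B] [ChartedSpace E B]
  {n : ℕ} [MulAction (Torus n) B]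
  {α : MForm F P 1} {π : P → B} {Φ : B → ((Fin n → ℝ) →L[ℝ] ℝ)}
  {c : (Fin n → ℝ) →L[ℝ] ℝ} {ε : ℝ} {ψ : (Fin n → ℝ) × P → P}

/-- A connection-preserving gauge transformation over a connected base which has a fixed point is
the identity: over each chart it acts by a constant element of the circle. -/
theorem IsPrincipalCircleBundle.eq_id_of_gauge [IsManifold 𝓘(ℝ, E) ∞ B] [ConnectedSpace B]
    (hπ : IsPrincipalCircleBundle F E π) (hα : IsConnectionForm α) {f : P → P}
    (hf : ∀ p, MDifferentiableAt 𝓘(ℝ, F) 𝓘(ℝ, F) f p) (hfπ : ∀ p, π (f p) = π p)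
    (hfs : ∀ (z : Circle) p, f (z • p) = z • f p)
    (hfα : ∀ p, MForm.pullDual 𝓘(ℝ, F) α f p = α.toDual p) {p₀ : P} (h0 : f p₀ = p₀) (p : P) :
    f p = p := by
  have hloc : ∀ b : B, ∃ U : Set B, IsOpen U ∧ b ∈ U ∧ ∃ w : Circle,
      (∀ p, π p ∈ U → f p = w • p) ∧ ∀ x ∈ U, ∃ p, π p = x := by
    intro b
    obtain ⟨U, s, z, hU, hbU, hs, hπs, -, hzs, -⟩ := hπ.exists_local_section b
    set φ := extChartAt 𝓘(ℝ, E) b with hφ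
    let σ : E → P := fun y => s (φ.symm y)
    set T : Set E := φ.target ∩ φ.symm ⁻¹' U
    have hTo : IsOpen T :=
      (continuousOn_extChartAt_symm b).isOpen_inter_preimage (isOpen_extChartAt_target b) hU
    have hbφ : φ.symm (φ b) = b := φ.left_inv (mem_extChartAt_source b)
    have hbT : φ b ∈ T := ⟨mem_extChartAt_target b, by rw [mem_preimage, hbφ]; exact hbU⟩
    have hσ : ContMDiffOn 𝓘(ℝ, E) 𝓘(ℝ, F) ∞ σ T :=
      hs.comp ((contMDiffOn_extChartAt_symm b).mono inter_subset_left) fun y hy => hy.2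
    obtain ⟨ρ, hρ, hball⟩ := Metric.isOpen_iff.1 hTo _ hbT
    have hσd : ∀ y ∈ Metric.ball (φ b) ρ, MDifferentiableAt 𝓘(ℝ, E) 𝓘(ℝ, F) σ y :=
      fun y hy => (hσ.contMDiffAt (hTo.mem_nhds (hball hy))).mdifferentiableAt (by simp)
    obtain ⟨w, hw⟩ := hπ.exists_smul_eqOn_of_pullDual_eq hα Metric.isOpen_ball
      (convex_ball (φ b) ρ) (f₁ := σ) (f₂ := fun y => f (σ y)) hσd
      (fun y hy => (hf _).comp y (hσd y hy)) (fun y hy => (hfπ _).symm) fun y hy => by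
        rw [MForm.pullDual_comp (f := f) (g := σ) α (hf _) (hσd y hy), hfα]
        rfl
    refine ⟨φ.source ∩ φ ⁻¹' Metric.ball (φ b) ρ, isOpen_extChartAt_preimage' b Metric.isOpen_ball,
      ⟨mem_extChartAt_source b, Metric.mem_ball_self hρ⟩, w, fun p hp => ?_, fun x hx => ?_⟩
    · have h1 : φ.symm (φ (π p)) = π p := φ.left_inv hp.1
      have h2 : π p ∈ U := by
        have := (hball hp.2).2
        rwa [mem_preimage, h1] at this
      have h3 := hw _ hp.2
      simp only [σ, h1] at h3
      rw [← hzs p h2, hfs, ← h3, smul_smul, smul_smul, mul_comm]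
    · have h1 : φ.symm (φ x) = x := φ.left_inv hx.1
      have h2 := (hball hx.2).2
      rw [mem_preimage, h1] at h2
      exact ⟨s x, hπs x h2⟩
  have hclopen : IsClopen {b : B | ∀ p, π p = b → f p = p} := by
    refine ⟨⟨?_⟩, ?_⟩
    · rw [isOpen_iff_mem_nhds]
      intro b hb
      obtain ⟨U, hU, hbU, w, hw, hsurj⟩ := hloc b
      filter_upwards [hU.mem_nhds hbU] with x hx hx'
      obtain ⟨q, hq⟩ := hsurj x hx
      have hw1 : w = 1 := hπ.eq_one_of_smul_eq ((hw q (hq ▸ hx)).symm.trans (hx' q hq))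
      refine hb fun p hp => ?_
      rw [hw p (hp ▸ hbU), hw1, one_smul]
    · rw [isOpen_iff_mem_nhds]
      intro b hb
      obtain ⟨U, hU, hbU, w, hw, hsurj⟩ := hloc b
      filter_upwards [hU.mem_nhds hbU] with x hx p hp
      obtain ⟨q, hq⟩ := hsurj b hbU
      have hw1 : w = 1 := hπ.eq_one_of_smul_eq ((hw q (hq ▸ hbU)).symm.trans (hb q hq))
      rw [hw p (hp ▸ hx), hw1, one_smul]
  have huniv := hclopen.eq_univ ⟨π p₀, fun p hp => by
    obtain ⟨z, rfl⟩ := hπ.exists_smul_eq hp.symm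
    rw [hfs, h0]⟩
  exact huniv.symm.subset (mem_univ (π p)) p rfl

namespace IsMomentLift

/-- A local family of lifts over the whole base extends to an action of the vector group. -/
theorem exists_additive_extension (hπ : IsPrincipalCircleBundle F E π) (hα : IsConnectionForm α)
    (hinv : ∀ (g : Torus n) b, Φ (g • b) = Φ b) (hε : 0 < ε) (h : IsMomentLift α π Φ c ε univ ψ) :
    ∃ χ, IsMomentLift α π Φ c ε univ χ ∧ ∀ Y Z p, χ (Y + Z, p) = χ (Y, χ (Z, p)) := by
  obtain ⟨χ, hadd, hχ⟩ := exists_extension_of_local_hom (A := Function.End P) hε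
    (ψ := fun Y p => ψ (Y, p)) (funext fun p => h.zero p (mem_univ _))
    fun Y Z hYZ => funext fun p => h.apply_add hπ hα hinv hYZ p
  have e : ∀ Y ∈ Metric.ball (0 : Fin n → ℝ) ε, ∀ p, χ Y p = ψ (Y, p) :=
    fun Y hY p => congrFun (hχ Y (mem_ball_zero_iff.1 hY)) p
  refine ⟨fun q => χ q.1 q.2, ⟨?_, ?_, ?_, ?_, ?_⟩, fun Y Z p => congrFun (hadd Y Z) p⟩
  · exact h.contMDiffOn.congr fun q hq => e q.1 hq.1 q.2
  · exact fun p hp => (e 0 (Metric.mem_ball_self hε) p).trans (h.zero p hp)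
  · exact fun Y hY p hp => (congrArg π (e Y hY p)).trans (h.proj Y hY p hp)
  · intro z Y hY p hp
    simp only [e Y hY]
    exact h.smul z Y hY p hp
  · intro Y hY p hp
    rw [← h.pullDual_eq Y hY p hp]
    apply MForm.pullDual_congr
    filter_upwards [(Metric.isOpen_ball.prod isOpen_univ).mem_nhds
      (show (Y, p) ∈ Metric.ball (0 : Fin n → ℝ) ε ×ˢ univ from ⟨hY, mem_univ _⟩)] with q hq
    exact e q.1 hq.1 q.2

theorem contMDiff_of_add (hπ : Continuous π) (hε : 0 < ε) (h : IsMomentLift α π Φ c ε univ ψ)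
    (hadd : ∀ Y Z p, ψ (Y + Z, p) = ψ (Y, ψ (Z, p))) :
    ContMDiff (𝓘(ℝ, Fin n → ℝ).prod 𝓘(ℝ, F)) 𝓘(ℝ, F) ∞ ψ := by
  have key : ∀ Y p, ContMDiffAt (𝓘(ℝ, Fin n → ℝ).prod 𝓘(ℝ, F)) 𝓘(ℝ, F) ∞ ψ (Y, p) := by
    intro Y
    refine induction_on_small_add (Q := fun Y => ∀ p,
      ContMDiffAt (𝓘(ℝ, Fin n → ℝ).prod 𝓘(ℝ, F)) 𝓘(ℝ, F) ∞ ψ (Y, p)) hε (fun Y hY p => ?_)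
      (fun Y Z hY hZ p => ?_) Y
    · exact h.contMDiffAt hπ isOpen_univ (mem_ball_zero_iff.2 hY) (mem_univ _)
    · have e : ψ = fun q : (Fin n → ℝ) × P => ψ (q.1 - Z, ψ (Z, q.2)) := by
        ext q
        rw [← hadd, sub_add_cancel]
      have h1 : ContMDiffAt (𝓘(ℝ, Fin n → ℝ).prod 𝓘(ℝ, F)) 𝓘(ℝ, Fin n → ℝ) ∞
          (fun q : (Fin n → ℝ) × P => q.1 - Z) (Y + Z, p) :=
        contMDiffAt_fst.sub contMDiffAt_const
      have h2 : ContMDiffAt (𝓘(ℝ, Fin n → ℝ).prod 𝓘(ℝ, F)) 𝓘(ℝ, F) ∞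
          (fun q : (Fin n → ℝ) × P => ψ (Z, q.2)) (Y + Z, p) :=
        ContMDiffAt.comp (g := ψ) (f := fun q : (Fin n → ℝ) × P => (Z, q.2)) (Y + Z, p) (hZ p)
          (contMDiffAt_const.prodMk contMDiffAt_snd)
      rw [e]
      refine ContMDiffAt.comp (g := ψ) (f := fun q : (Fin n → ℝ) × P => (q.1 - Z, ψ (Z, q.2)))
        (Y + Z, p) ?_ (h1.prodMk h2)
      simp only [add_sub_cancel_right]
      exact hY _
  exact fun q => key q.1 q.2

/-- Each member of an additive family of lifts preserves the connection form. -/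
theorem pullDual_right_of_add (hπ : Continuous π) (hε : 0 < ε)
    (h : IsMomentLift α π Φ c ε univ ψ) (hadd : ∀ Y Z p, ψ (Y + Z, p) = ψ (Y, ψ (Z, p)))
    (Y : Fin n → ℝ) :
    ∀ p, MForm.pullDual 𝓘(ℝ, F) α (fun q => ψ (Y, q)) p = α.toDual p := by
  have hs := h.contMDiff_of_add hπ hε hadd
  refine induction_on_small_add (Q := fun Y => ∀ p,
    MForm.pullDual 𝓘(ℝ, F) α (fun q => ψ (Y, q)) p = α.toDual p) hε (fun Y hY p => ?_)
    (fun Y Z hY hZ p => ?_) Y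
  · have hi : MDifferentiableAt 𝓘(ℝ, F) 𝓘(ℝ, F) (fun q : P => q) p := mdifferentiableAt_id
    have hc : MDifferentiableAt 𝓘(ℝ, F) 𝓘(ℝ, Fin n → ℝ) (fun _ : P => Y) p :=
      mdifferentiableAt_const
    rw [MForm.pullDual_comp (f := ψ) (g := fun q : P => (Y, q)) α
      ((hs (Y, p)).mdifferentiableAt (by simp)) (hc.prodMk hi),
      h.pullDual_eq Y (mem_ball_zero_iff.2 hY) p (mem_univ _), modelDeriv_prodMk hc hi,
      modelDeriv_const, modelDeriv_id]
    ext v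
    simp
  · have e : (fun q => ψ (Y + Z, q)) = fun q => ψ (Y, ψ (Z, q)) := funext (hadd Y Z)
    rw [e, MForm.pullDual_comp (f := fun q => ψ (Y, q)) (g := fun q => ψ (Z, q)) α
      (mdifferentiableAt_slice_right ((hs (Y, _)).mdifferentiableAt (by simp)))
      (mdifferentiableAt_slice_right ((hs (Z, _)).mdifferentiableAt (by simp))), hY]
    exact hZ p

/-- The lifts of the integral lattice are trivial, if the moment map is normalized at a fixed
point. -/
theorem apply_eq_self_of_torusExp_eq_one [IsManifold 𝓘(ℝ, E) ∞ B] [ConnectedSpace B]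
    (hπ : IsPrincipalCircleBundle F E π) (hα : IsConnectionForm α) (hε : 0 < ε)
    (h : IsMomentLift α π Φ c ε univ ψ) (hadd : ∀ Y Z p, ψ (Y + Z, p) = ψ (Y, ψ (Z, p)))
    {b₀ : B} (hb₀ : b₀ ∈ MulAction.fixedPoints (Torus n) B) (hc : c = Φ b₀)
    {Y : Fin n → ℝ} (hY : torusExp Y = 1) (p : P) : ψ (Y, p) = p := by
  have hcont := hπ.smooth_proj.continuous
  have hs := h.contMDiff_of_add hcont hε hadd
  obtain ⟨p₀, rfl⟩ : ∃ p₀, π p₀ = b₀ := by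
    obtain ⟨U, s, -, -, hbU, -, hπs, -⟩ := hπ.exists_local_section b₀
    exact ⟨s b₀, hπs b₀ hbU⟩
  -- over `b₀` even the whole vector group acts trivially
  have h0 : ψ (Y, p₀) = p₀ := by
    refine induction_on_small_add (Q := fun Y => ψ (Y, p₀) = p₀) hε
      (fun Y hY => h.apply_of_fixed hπ hα hb₀ hc (mem_ball_zero_iff.2 hY)) (fun Y Z hY hZ => ?_) Y
    rw [hadd, hZ, hY]
  exact hπ.eq_id_of_gauge hα (f := fun p => ψ (Y, p))
    (fun p => mdifferentiableAt_slice_right ((hs (Y, p)).mdifferentiableAt (by simp)))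
    (fun p => by rw [h.proj_of_add hε hadd, hY, one_smul]) (h.smul_of_add hε hadd Y)
    (h.pullDual_right_of_add hcont hε hadd Y) h0 p

end IsMomentLift

theorem IsPrincipalCircleBundle.modelDeriv_proj_circleField
    (hπ : IsPrincipalCircleBundle F E π) (p : P) :
    modelDeriv 𝓘(ℝ, F) 𝓘(ℝ, E) π p (circleField F p) = 0 := by
  have hK : MDifferentiableAt 𝓘(ℝ, ℝ) 𝓘(ℝ, F)
      (fun t : ℝ => Circle.exp (2 * Real.pi * t) • p) 0 :=
    hπ.mdifferentiableAt_smul (mdifferentiableAt_circleExp_two_pi 0) mdifferentiableAt_const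
  have h1 := modelDeriv_comp (f := π) (g := fun t : ℝ => Circle.exp (2 * Real.pi * t) • p)
    ((hπ.smooth_proj _).mdifferentiableAt (by simp)) hK
  simp only [hπ.proj_smul, modelDeriv_const, mul_zero, Circle.exp_zero, one_smul] at h1
  exact (congrArg (fun L => L (1 : ℝ)) h1).symm

end LiftedAction

theorem mainTheorem2
    {E : Type*} [NormedAddCommGroup E] [NormedSpace ℝ E] [FiniteDimensional ℝ E]
    {F : Type*} [NormedAddCommGroup F] [NormedSpace ℝ F] [FiniteDimensional ℝ F]
    {B : Type*} [TopologicalSpace B] [ChartedSpace E B] [IsManifold 𝓘(ℝ, E) ∞ B]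
    [T2Space B] [CompactSpace B] [ConnectedSpace B]
    {P : Type*} [TopologicalSpace P] [ChartedSpace F P] [IsManifold 𝓘(ℝ, F) ∞ P]
    [T2Space P] [MulAction Circle P]
    (Ω : MForm E B 2) (hΩ : IsSymplecticForm Ω)
    (π : P → B) (hπ : IsPrincipalCircleBundle F E π)
    (α : MForm F P 1) (hα : IsConnectionForm α) (hcurv : α.d = MForm.pullback π Ω)
    (n : ℕ) [MulAction (Torus n) B]
    (Φ : B → ((Fin n → ℝ) →L[ℝ] ℝ)) (hΦ : IsHamiltonianTorusAction Ω Φ) :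
    (MulAction.fixedPoints (Torus n) B).Nonempty ∧
    ∀ b₀ ∈ MulAction.fixedPoints (Torus n) B,
      ∃ _ : MulAction (Torus n) P,
        IsSmoothTorusAction n F P ∧
        (∀ g : Torus n, MForm.pullback (fun p : P => g • p) α = α) ∧
        (∀ (g : Torus n) (p : P), π (g • p) = g • π p) ∧
        ∀ (X : Fin n → ℝ) (p : P), ∃ v : TangentSpace 𝓘(ℝ, F) p,
          IsHorizontalLift α π p (inducedField E X (π p)) v ∧
          inducedField F X p = v - (Φ (π p) X - Φ b₀ X) • circleField F p := by
  refine ⟨hΦ.fixedPoints_nonempty hΩ, fun b₀ hb₀ => ?_⟩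
  have hcont := hπ.smooth_proj.continuous
  obtain ⟨ε, hε, ψ₀, hψ₀⟩ := exists_isMomentLift_univ hπ hα hcurv hΦ (Φ b₀)
  obtain ⟨ψ, hψ, hadd⟩ := hψ₀.exists_additive_extension hπ hα hΦ.invariant hε
  have hs := hψ.contMDiff_of_add hcont hε hadd
  have hwd : ∀ {Y Z : Fin n → ℝ}, torusExp Y = torusExp Z → ∀ p, ψ (Y, p) = ψ (Z, p) := by
    intro Y Z hYZ p
    have h1 : torusExp (Y - Z) = 1 := by
      have := torusExp_add (Y - Z) Z
      rw [sub_add_cancel, hYZ] at this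
      exact right_eq_mul.1 this
    rw [← sub_add_cancel Y Z, hadd]
    exact hψ.apply_eq_self_of_torusExp_eq_one hπ hα hε hadd hb₀ rfl h1 _
  -- logarithms on the torus; by `hwd` the action below does not depend on their choice
  let σ : Torus n → (Fin n → ℝ) := Function.surjInv torusExp_surjective
  have hσ : ∀ g, torusExp (σ g) = g := Function.surjInv_eq torusExp_surjective
  let A : MulAction (Torus n) P :=
    { smul := fun g p => ψ (σ g, p)
      one_smul := fun p => (hwd ((hσ 1).trans torusExp_zero.symm) p).trans (hψ.zero p (mem_univ _))
      mul_smul := fun g g' p => (hwd (by rw [hσ, torusExp_add, hσ, hσ]) p).trans (hadd _ _ p) }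
  have hA : ∀ (Y : Fin n → ℝ) (p : P), torusExp Y • p = ψ (Y, p) := fun Y p => hwd (hσ _) p
  have hact : IsSmoothTorusAction n F P := by
    have : (fun q : (Fin n → ℝ) × P => torusExp q.1 • q.2) = ψ := funext fun q => hA q.1 q.2
    rw [IsSmoothTorusAction, this]
    exact hs
  refine ⟨A, hact, fun g => ?_, fun g p => ?_, fun X p => ?_⟩
  · funext p
    have h1 := hψ.pullDual_right_of_add hcont hε hadd (σ g) p
    have h2 : ∀ x : F, α.model (ψ (σ g, p)) ![modelDeriv 𝓘(ℝ, F) 𝓘(ℝ, F)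
        (fun q => ψ (σ g, q)) p x] = α.model p ![x] := by
      intro x
      rw [← MForm.toDual_apply, ← MForm.toDual_apply, ← h1, MForm.pullDual_apply]
    have h3 : (α.model (ψ (σ g, p))).compContinuousLinearMap
        (modelDeriv 𝓘(ℝ, F) 𝓘(ℝ, F) (fun q => ψ (σ g, q)) p) = α.model p := by
      ext v
      have hv : v = ![v 0] := by ext i; fin_cases i; rfl
      rw [hv]
      refine Eq.trans ?_ (h2 (v 0))
      change α.model (ψ (σ g, p)) _ = α.model (ψ (σ g, p)) _
      congr 1
      ext i; fin_cases i; rfl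
    exact h3
  · exact (hψ.proj_of_add hε hadd (σ g) p).trans (by rw [hσ])
  · have h0 : (0 : Fin n → ℝ) ∈ Metric.ball (0 : Fin n → ℝ) ε := Metric.mem_ball_self hε
    have hw := hact.modelDeriv_exp p X
    have hwα : α.toDual p (modelField F X p) = Φ b₀ X - Φ (π p) X := by
      have h1 := congrArg (fun L : (Fin n → ℝ) →L[ℝ] ℝ => L X)
        (hψ.pullDual_left hcont isOpen_univ h0 (mem_univ (π p)))
      simp only [MForm.pullDual_apply, hψ.zero p (mem_univ _)] at h1
      rw [← hw]
      simp only [hA]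
      exact h1
    have hwπ : modelDeriv 𝓘(ℝ, F) 𝓘(ℝ, E) π p (modelField F X p) = modelField E X (π p) := by
      have h1 := modelDeriv_comp (f := π) (g := fun Z : Fin n → ℝ => torusExp Z • p)
        ((hπ.smooth_proj _).mdifferentiableAt (by simp)) (hact.mdifferentiableAt_left 0 p)
      simp only [torusExp_zero, one_smul] at h1
      rw [← hw, ← hΦ.smooth_action.modelDeriv_exp]
      refine (congrArg (fun L : (Fin n → ℝ) →L[ℝ] E => L X) h1).symm.trans ?_
      have h2 : (fun Z : Fin n → ℝ => π (torusExp Z • p)) = fun Z => torusExp Z • π p :=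
        funext fun Z => (congrArg π (hA Z p)).trans (hψ.proj_of_add hε hadd Z p)
      rw [h2]
    have hRα : α.toDual p (circleField F p) = 1 :=
      (α.toDual_apply p _).trans (hα.normalized p)
    have hRπ := hπ.modelDeriv_proj_circleField p
    set R : F := circleField F p with hR
    let v : F := modelField F X p + (Φ (π p) X - Φ b₀ X) • R
    refine ⟨v, ⟨?_, ?_⟩, ?_⟩
    · have : α.toDual p v = 0 := by
        rw [map_add, map_smul, hwα, hRα]
        simp
      rw [← this]
      exact (α.toDual_apply p v).symm
    · have : modelDeriv 𝓘(ℝ, F) 𝓘(ℝ, E) π p v = modelField E X (π p) := by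
        rw [map_add, map_smul, hwπ, hRπ, smul_zero, add_zero]
      exact this
    · have : modelField F X p = v - (Φ (π p) X - Φ b₀ X) • R := (add_sub_cancel_right _ _).symm
      exact this
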